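/- Let $K$ be a field. A bialgebra $H$ over $K$ (unital associative product $*$, counital coassociative coproduct $\Delta$) is called \emph{cofree} if, as a coalgebra, it is isomorphic to the tensor coalgebra $T^c(\mathrm{Prim}\, H)$, where $\mathrm{Prim}\, H=\{x\in H:\Delta(x)=x\otimes 1+1\otimes x\}$ and $T^c(V)=\bigoplus_{n\ge 0}V^{\otimes n}$ carries the deconcatenation coproduct $\Delta(v_1\cdots v_n)=\sum_{i=0}^n v_1\cdots v_i\otimes v_{i+1}\cdots v_n$. A \emph{$B_\infty$-algebra} is a $K$-vector space $R$ with linear maps $M_{pq}:R^{\otimes p}\otimes R^{\otimes q}\to R$ ($p,q\ge 0$) such that $M_{00}=0$, $M_{10}=\mathrm{Id}=M_{01}$, $M_{n0}=0=M_{0n}$ for $n\ge 2$, and, for all $i,j,k\ge 1$, $$\sum_{1\le l\le i+j}\ \sum M_{lk}\circ\big(M_{i_1j_1}\cdots M_{i_lj_l}\otimes \mathrm{Id}^{\otimes k}\big)=\sum_{1\le m\le j+k}\ \sum M_{im}\circ\big(\mathrm{Id}^{\otimes i}\otimes M_{j_1k_1}\cdots M_{j_mk_m}\big),$$ where the inner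 sums run over all $i_1+\dots+i_l=i$, $j_1+\dots+j_l=j$ (resp. $j_1+\dots+j_m=j$, $k_1+\dots+k_m=k$) in $\mathbb{Z}_{\ge 0}$, and $M_{i_1j_1}\cdots M_{i_lj_l}$ applies the operations to consecutive blocks of the two words. A \emph{2-associative algebra} is a vector space with two associative products $*$ and $\cdot$ having the same unit. On it one defines $M_{00}=0$, $M_{10}=\mathrm{Id}=M_{01}$, $M_{n0}=0=M_{0n}$ for $n\ge 2$, and inductively, for $p,q\ge 1$, $$M_{pq}(u_1\cdots u_p,v_1\cdots v_q)=(u_1\cdot\ldots\cdot u_p)*(v_1\cdot\ldots\cdot v_q)-\sum_{k\ge 2}\ \sum M_{i_1j_1}\cdot\ldots\cdot M_{i_kj_k}(u_1\cdots u_p,v_1\cdots v_q),$$ the inner sum being over all $i_1+\dots+i_k=p$, $j_1+\dots+j_k=q$, where terms with some $(i_l,j_l)=(0,0)$ vanish. For a $B_\infty$-algebra $R$, let $U2(R)$ be the quotient of the free 2-associative algebra on the vector space $R$ by the 2-associative ideal identifying, for all $r_1,\dots,r_p,s_1,\dots,s_q\in R$, the element $M_{pq}(r_1\cdots r_p,s_1\cdots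 s_q)$ computed in $R$ with the one computed in the free 2-associative algebra. It is a bialgebra for the product $*$ and the unique coproduct $\Delta$ for which the image of $R$ is primitive, $\Delta(x*y)=\Delta(x)*\Delta(y)$ and $\Delta(x\cdot y)=(x\otimes 1)\cdot\Delta(y)+\Delta(x)\cdot(1\otimes y)-x\otimes y$; its counit is multiplicative for both products and vanishes on the image of $R$. \textbf{Statement.} The category of cofree bialgebras over $K$ is equivalent to the category of bialgebras of the form $U2(R)$ with $R$ a $B_\infty$-algebra (that is, bialgebras isomorphic to some $U2(R)$), both being full subcategories of the category of bialgebras over $K$ and bialgebra morphisms. Moreover, the equivalence can be chosen to be compatible, up to natural isomorphism, with the inclusions into the category of all bialgebras. -/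

import Mathlib

open scoped TensorProduct

universe u v

namespace CofreeHopf

section BlockSums

/-- The sum of `F [m u₁ v₁, …, m u_k v_k]` over all ways of cutting the words `u` and `v` into `k`
consecutive blocks, `u = u₁ ⋯ u_k` and `v = v₁ ⋯ v_k`. Blocks may be empty, but for no `l` are
`u_l` and `v_l` both empty: such a term would contain the factor `M₀₀ = 0`.
With `i_l = |u_l|`, `j_l = |v_l|` this is the sum, over the indices `(i₁, …, i_k; j₁, …, j_k)` with
`∑ i_l = |u|` and `∑ j_l = |v|`, of `F (M_{i₁ j₁} ⋯ M_{i_k j_k} (u, v))`. -/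
def blockSum {R S X : Type*} [AddCommMonoid X] (m : List R → List R → S) :
    ℕ → List R → List R → (List S → X) → X
  | 0, u, v, F => if u.length = 0 ∧ v.length = 0 then F [] else 0
  | k + 1, u, v, F =>
      ∑ i ∈ Finset.range (u.length + 1), ∑ j ∈ Finset.range (v.length + 1),
        if i = 0 ∧ j = 0 then 0
        else blockSum m k (u.drop i) (v.drop j) (fun w => F (m (u.take i) (v.take j) :: w))

variable {R S X : Type*} [AddCommMonoid X]

theorem blockSum_of_lt (m : List R → List R → S) (k : ℕ) (u v : List R) (F : List S → X)
    (h : u.length + v.length < k) : blockSum m k u v F = 0 := by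
  induction k generalizing u v F with
  | zero => omega
  | succ k ih =>
    rw [blockSum]
    refine Finset.sum_eq_zero fun i hi => Finset.sum_eq_zero fun j hj => ?_
    split_ifs with h0
    · rfl
    · apply ih
      simp only [Finset.mem_range, List.length_drop] at *
      omega

theorem blockSum_one (m : List R → List R → S) (u v : List R) (F : List S → X)
    (h : ¬(u.length = 0 ∧ v.length = 0)) : blockSum m 1 u v F = F [m u v] := by
  rw [blockSum, Finset.sum_eq_single u.length, Finset.sum_eq_single v.length]
  · simp only [blockSum, List.length_drop, List.take_length, Nat.sub_self, and_self, if_true]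
    rw [if_neg h]
  · intro j hj hne
    simp only [Finset.mem_range] at hj
    simp only [blockSum, List.length_drop]
    rw [if_neg (c := _ ∧ v.length - j = 0) (by omega)]
    simp
  · simp
  · intro i hi hne
    simp only [Finset.mem_range] at hi
    refine Finset.sum_eq_zero fun j hj => ?_
    simp only [blockSum, List.length_drop]
    rw [if_neg (c := u.length - i = 0 ∧ _) (by omega)]
    simp
  · simp

theorem map_blockSum {Y : Type*} [AddCommMonoid Y] (g : X →+ Y) (m : List R → List R → S) (k : ℕ)
    (u v : List R) (F : List S → X) :
    blockSum m k u v (fun w => g (F w)) = g (blockSum m k u v F) := by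
  induction k generalizing u v F with
  | zero => simp only [blockSum]; split_ifs <;> simp
  | succ k ih =>
    simp only [blockSum, map_sum]
    refine Finset.sum_congr rfl fun i _ => Finset.sum_congr rfl fun j _ => ?_
    split_ifs
    · simp
    · exact ih _ _ (fun w => F (m (u.take i) (v.take j) :: w))

theorem blockSum_congr (m m' : List R → List R → S) (N : ℕ)
    (hm : ∀ a b, a.length + b.length ≤ N → m a b = m' a b) (k : ℕ) (u v : List R) (F : List S → X)
    (h : u.length + v.length ≤ N) : blockSum m k u v F = blockSum m' k u v F := by
  induction k generalizing u v F with
  | zero => rfl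
  | succ k ih =>
    simp only [blockSum]
    refine Finset.sum_congr rfl fun i hi => Finset.sum_congr rfl fun j hj => ?_
    simp only [Finset.mem_range] at hi hj
    rw [hm _ _ (by simp only [List.length_take]; omega),
      ih _ _ _ (by simp only [List.length_drop]; omega)]

theorem blockSum_congr_of_two_le (m m' : List R → List R → S) (k : ℕ) (hk : 2 ≤ k) (u v : List R)
    (hm : ∀ a b, a.length + b.length < u.length + v.length → m a b = m' a b) (F : List S → X) :
    blockSum m k u v F = blockSum m' k u v F := by
  obtain ⟨k, rfl⟩ : ∃ l, k = l + 1 := ⟨k - 1, by omega⟩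
  simp only [blockSum]
  refine Finset.sum_congr rfl fun i hi => Finset.sum_congr rfl fun j hj => ?_
  simp only [Finset.mem_range] at hi hj
  split_ifs with h0
  · rfl
  by_cases h1 : i = u.length ∧ j = v.length
  · rw [blockSum_of_lt, blockSum_of_lt] <;> simp only [List.length_drop] <;> omega
  · rw [hm _ _ (by simp only [List.length_take]; omega),
      blockSum_congr m m' (u.length + v.length - 1) (fun a b hab => hm a b (by omega))]
    simp only [List.length_drop]; omega

end BlockSums

section BInfinity

/-- The value of a family of `(p+q)`-ary operations on a pair of words. -/
def evalWords {K R : Type*} [Field K] [AddCommGroup R] [Module K R]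
    (M : (p q : ℕ) → MultilinearMap K (fun _ : Fin p => R) (MultilinearMap K (fun _ : Fin q => R) R))
    (u v : List R) : R :=
  M u.length v.length u.get v.get

/-- A `B_∞`-algebra structure on the vector space `R`: operations
`M_{pq} : R^{⊗p} ⊗ R^{⊗q} → R` (as multilinear maps), normalized in low arity, with the relation
`∑_l M_{lk} ∘ (M^l_{(i,j)} ⊗ Id^{⊗k}) = ∑_m M_{im} ∘ (Id^{⊗i} ⊗ M^m_{(j,k)})`
for all positive `i`, `j`, `k`, evaluated on words `u`, `v`, `w` of lengths `i`, `j`, `k`. -/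
class BInfinityAlgebra (K R : Type*) [Field K] [AddCommGroup R] [Module K R] where
  M : (p q : ℕ) → MultilinearMap K (fun _ : Fin p => R) (MultilinearMap K (fun _ : Fin q => R) R)
  M_zero_zero : M 0 0 = 0
  M_one_zero : ∀ u v, M 1 0 u v = u 0
  M_zero_one : ∀ u v, M 0 1 u v = v 0
  M_left_zero : ∀ n, 2 ≤ n → M n 0 = 0
  M_zero_right : ∀ n, 2 ≤ n → M 0 n = 0
  rel : ∀ u v w : List R, 0 < u.length → 0 < v.length → 0 < w.length →
    ∑ l ∈ Finset.Icc 1 (u.length + v.length),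
        blockSum (evalWords M) l u v (fun x => evalWords M x w) =
      ∑ m ∈ Finset.Icc 1 (v.length + w.length),
        blockSum (evalWords M) m v w (fun x => evalWords M u x)

/-- `M_{pq}(u₁ ⋯ u_p, v₁ ⋯ v_q)` in a `B_∞`-algebra. -/
def BInfinityAlgebra.op (K : Type*) {R : Type*} [Field K] [AddCommGroup R] [Module K R]
    [BInfinityAlgebra K R] (u v : List R) : R :=
  evalWords (BInfinityAlgebra.M (K := K)) u v

end BInfinity

section TwoAssoc

/-- A (unital) 2-associative algebra: the ring multiplication is the first product `*`, and
`dot` is the second associative product `·`; both products have the unit `1`. -/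
class TwoAssocAlgebra (K A : Type*) [Field K] [Ring A] [Algebra K A] where
  dot : A →ₗ[K] A →ₗ[K] A
  dot_assoc : ∀ x y z, dot (dot x y) z = dot x (dot y z)
  one_dot : ∀ x, dot 1 x = x
  dot_one : ∀ x, dot x 1 = x


/-- An associative algebra as a 2-associative algebra with equal products. -/
@[reducible] def TwoAssocAlgebra.ofMul (K A : Type*) [Field K] [Ring A] [Algebra K A] :
    TwoAssocAlgebra K A where
  dot := LinearMap.mul K A
  dot_assoc := mul_assoc
  one_dot := one_mul
  dot_one := mul_one

instance (K : Type*) [Field K] : TwoAssocAlgebra K K := .ofMul K K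

instance (K V : Type*) [Field K] [AddCommGroup V] [Module K V] :
    TwoAssocAlgebra K (TensorAlgebra K V) := .ofMul K _

variable (K : Type*) {A : Type*} [Field K] [Ring A] [Algebra K A] [TwoAssocAlgebra K A]

/-- The product `u₁ · u₂ · ⋯ · u_p`. -/
def dotProd (w : List A) : A := w.foldr (fun a b => TwoAssocAlgebra.dot (K := K) a b) 1

/-- `mPQAux K n` computes the operations `mPQ K u v` for words with `|u| + |v| ≤ n`. -/
def mPQAux : ℕ → List A → List A → A
  | 0, _, _ => 0
  | _ + 1, [], [] => 0
  | _ + 1, [x], [] => x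
  | _ + 1, _ :: _ :: _, [] => 0
  | _ + 1, [], [y] => y
  | _ + 1, [], _ :: _ :: _ => 0
  | n + 1, x :: u, y :: v =>
      dotProd K (x :: u) * dotProd K (y :: v) -
        ∑ k ∈ Finset.Icc 2 ((x :: u).length + (y :: v).length),
          blockSum (mPQAux n) k (x :: u) (y :: v) (dotProd K)

/-- The operation `M_{pq}(u₁ ⋯ u_p, v₁ ⋯ v_q)` of the `B_∞`-algebra attached to a 2-associative
algebra. It is determined by `mPQ_nil_nil`, …, `mPQ_cons_cons` below. -/
def mPQ (u v : List A) : A := mPQAux K (u.length + v.length) u v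

theorem mPQAux_eq (n n' : ℕ) (u v : List A) (hn : u.length + v.length ≤ n)
    (hn' : u.length + v.length ≤ n') : mPQAux K n u v = mPQAux K n' u v := by
  induction n generalizing n' u v with
  | zero =>
    have hu : u = [] := List.length_eq_zero_iff.mp (by omega)
    have hv : v = [] := List.length_eq_zero_iff.mp (by omega)
    subst hu hv
    cases n' <;> simp [mPQAux]
  | succ n ih =>
    match n', u, v, hn, hn' with
    | 0, [], [], _, _ => simp [mPQAux]
    | 0, _ :: _, _, _, hn' => simp at hn'
    | 0, [], _ :: _, _, hn' => simp at hn'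
    | n' + 1, [], [], _, _ => simp [mPQAux]
    | n' + 1, [x], [], _, _ => simp [mPQAux]
    | n' + 1, _ :: _ :: _, [], _, _ => simp [mPQAux]
    | n' + 1, [], [y], _, _ => simp [mPQAux]
    | n' + 1, [], _ :: _ :: _, _, _ => simp [mPQAux]
    | n' + 1, x :: u, y :: v, hn, hn' =>
      simp only [mPQAux]
      congr 1
      refine Finset.sum_congr rfl fun k hk => ?_
      refine blockSum_congr_of_two_le _ _ k (Finset.mem_Icc.mp hk).1 _ _ (fun a b hab => ?_) _
      exact ih _ _ _ (by omega) (by omega)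

@[simp] theorem mPQ_nil_nil : mPQ K ([] : List A) [] = 0 := by simp [mPQ, mPQAux]

theorem mPQ_one_zero (x : A) : mPQ K [x] [] = x := by simp [mPQ, mPQAux]

theorem mPQ_zero_one (y : A) : mPQ K [] [y] = y := by simp [mPQ, mPQAux]

theorem mPQ_left_zero (u : List A) (hu : 2 ≤ u.length) : mPQ K u [] = 0 := by
  match u, hu with
  | _ :: _ :: _, _ => simp [mPQ, mPQAux]

theorem mPQ_zero_right (v : List A) (hv : 2 ≤ v.length) : mPQ K [] v = 0 := by
  match v, hv with
  | _ :: _ :: _, _ => simp [mPQ, mPQAux]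

/-- `M_{pq}(u, v) = (u₁ · ⋯ · u_p) * (v₁ · ⋯ · v_q) - ∑_{k ≥ 2} ∑ M_{i₁j₁} · ⋯ · M_{i_kj_k}(u, v)`
for `p, q ≥ 1`. -/
theorem mPQ_of_pos (u v : List A) (hu : 0 < u.length) (hv : 0 < v.length) :
    mPQ K u v = dotProd K u * dotProd K v -
      ∑ k ∈ Finset.Icc 2 (u.length + v.length), blockSum (mPQ K) k u v (dotProd K) := by
  match u, v, hu, hv with
  | x :: u, y :: v, _, _ =>
    rw [mPQ, show (x :: u).length + (y :: v).length = (u.length + v.length + 1) + 1 by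
      simp only [List.length_cons]; omega, mPQAux]
    congr 1
    rw [show (x :: u).length + (y :: v).length = (u.length + v.length + 1) + 1 by
      simp only [List.length_cons]; omega]
    refine Finset.sum_congr rfl fun k hk => ?_
    refine blockSum_congr_of_two_le _ _ k (Finset.mem_Icc.mp hk).1 _ _ (fun a b hab => ?_) _
    simp only [List.length_cons] at hab
    exact mPQAux_eq K _ _ _ _ (by omega) le_rfl

/-- The sum of `g u₁ v₁ u₂ v₂` over the ways to cut off first blocks `u₁`, `v₁`, not both empty. -/
def cutSum {R X : Type*} [AddCommMonoid X] (u v : List R)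
    (g : List R → List R → List R → List R → X) : X :=
  ∑ i ∈ Finset.range (u.length + 1), ∑ j ∈ Finset.range (v.length + 1),
    if i = 0 ∧ j = 0 then 0 else g (u.take i) (v.take j) (u.drop i) (v.drop j)

theorem cutSum_congr {R X : Type*} [AddCommMonoid X] (u v : List R)
    (g g' : List R → List R → List R → List R → X)
    (h : ∀ a b c d, u = a ++ c → v = b ++ d → ¬(a = [] ∧ b = []) → g a b c d = g' a b c d) :
    cutSum u v g = cutSum u v g' := by
  refine Finset.sum_congr rfl fun i hi => Finset.sum_congr rfl fun j hj => ?_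
  simp only [Finset.mem_range] at hi hj
  split_ifs with h0
  · rfl
  · refine h _ _ _ _ (List.take_append_drop i u).symm (List.take_append_drop j v).symm ?_
    intro ⟨h1, h2⟩
    have h1 := congrArg List.length h1
    have h2 := congrArg List.length h2
    simp only [List.length_take, List.length_nil] at h1 h2
    omega

theorem blockSum_dotProd_succ {R : Type*} (m : List R → List R → A) (k : ℕ) (u v : List R) :
    blockSum m (k + 1) u v (dotProd K) = cutSum u v (fun a b c d =>
      TwoAssocAlgebra.dot (K := K) (m a b) (blockSum m k c d (dotProd K))) := by
  simp only [blockSum, cutSum]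
  refine Finset.sum_congr rfl fun i _ => Finset.sum_congr rfl fun j _ => ?_
  split_ifs with h0
  · rfl
  · exact map_blockSum (TwoAssocAlgebra.dot (K := K) (m (u.take i) (v.take j))).toAddMonoidHom
      m k (u.drop i) (v.drop j) (dotProd K)

/-- The sum over all numbers of blocks. -/
def totalSum {R : Type*} (m : List R → List R → A) (u v : List R) : A :=
  ∑ k ∈ Finset.range (u.length + v.length + 1), blockSum m k u v (dotProd K)

theorem totalSum_eq {R : Type*} (m : List R → List R → A) (u v : List R) (N : ℕ)
    (hN : u.length + v.length ≤ N) :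
    ∑ k ∈ Finset.range (N + 1), blockSum m k u v (dotProd K) = totalSum K m u v := by
  refine (Finset.sum_subset ?_ ?_).symm
  · intro k; simp only [Finset.mem_range]; omega
  · intro k _ hk
    refine blockSum_of_lt _ _ _ _ _ ?_
    simp only [Finset.mem_range] at hk; omega

theorem totalSum_nil {R : Type*} (m : List R → List R → A) : totalSum K m [] [] = 1 := by
  simp [totalSum, blockSum, dotProd]

theorem totalSum_rec {R : Type*} (m : List R → List R → A) (u v : List R)
    (h : ¬(u.length = 0 ∧ v.length = 0)) :
    totalSum K m u v = cutSum u v (fun a b c d =>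
      TwoAssocAlgebra.dot (K := K) (m a b) (totalSum K m c d)) := by
  rw [← totalSum_eq K m u v (u.length + v.length + 1) (by omega), Finset.sum_range_succ']
  simp only [blockSum_dotProd_succ]
  rw [blockSum, if_neg h, add_zero]
  simp only [cutSum]
  rw [Finset.sum_comm]
  refine Finset.sum_congr rfl fun i hi => ?_
  rw [Finset.sum_comm]
  refine Finset.sum_congr rfl fun j hj => ?_
  split_ifs with h0
  · simp
  · rw [← map_sum, totalSum_eq]
    simp only [List.length_drop]; omega

@[simp] theorem dotProd_nil : dotProd K ([] : List A) = 1 := rfl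

@[simp] theorem dotProd_cons (x : A) (u : List A) :
    dotProd K (x :: u) = TwoAssocAlgebra.dot (K := K) x (dotProd K u) := rfl

theorem totalSum_mPQ (u v : List A) : totalSum K (mPQ K) u v = dotProd K u * dotProd K v := by
  by_cases hu : u.length = 0
  · obtain rfl := List.length_eq_zero_iff.mp hu
    rw [dotProd_nil, one_mul]
    clear hu
    induction v with
    | nil => exact totalSum_nil K _
    | cons y v ih =>
      rw [totalSum_rec _ _ _ _ (by simp)]
      simp only [cutSum, List.length_nil, zero_add, Finset.sum_range_one, true_and]
      rw [Finset.sum_eq_single 1]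
      · simp [mPQ_zero_one, ih]
      · intro j hj hne
        simp only [Finset.mem_range] at hj
        split_ifs with h0
        · rfl
        · rw [List.take_nil, mPQ_zero_right]
          · simp
          · simp only [List.length_take]; omega
      · simp
  by_cases hv : v.length = 0
  · obtain rfl := List.length_eq_zero_iff.mp hv
    rw [dotProd_nil, mul_one]
    clear hu hv
    induction u with
    | nil => exact totalSum_nil K _
    | cons y v ih =>
      rw [totalSum_rec _ _ _ _ (by simp)]
      simp only [cutSum, List.length_nil, zero_add, Finset.sum_range_one, and_true]
      rw [Finset.sum_eq_single 1]
      · simp [mPQ_one_zero, ih]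
      · intro j hj hne
        simp only [Finset.mem_range] at hj
        split_ifs with h0
        · rfl
        · rw [List.take_nil, mPQ_left_zero]
          · simp
          · simp only [List.length_take]; omega
      · simp
  rw [totalSum, Finset.range_eq_Ico, Finset.sum_eq_sum_Ico_succ_bot (by omega),
    Finset.sum_eq_sum_Ico_succ_bot (by omega), blockSum, if_neg (by omega),
    blockSum_one _ _ _ _ (by omega), dotProd_cons, dotProd_nil, TwoAssocAlgebra.dot_one,
    mPQ_of_pos K u v (by omega) (by omega),
    show Finset.Ico (0 + 1 + 1) (u.length + v.length + 1) =
      Finset.Icc 2 (u.length + v.length) by ext; simp]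
  abel

theorem cutSum_mPQ (u v : List A) (h : ¬(u.length = 0 ∧ v.length = 0)) :
    cutSum u v (fun a b c d =>
      TwoAssocAlgebra.dot (K := K) (mPQ K a b) (dotProd K c * dotProd K d)) =
      dotProd K u * dotProd K v := by
  simp only [← totalSum_mPQ]
  exact (totalSum_rec K _ u v h).symm

theorem cutSum_unique {R : Type*} (h h' : List R → List R → A) (Q : List R → List R → A)
    (hQ : Q [] [] = 1) (h0 : h [] [] = h' [] [])
    (H : ∀ u v, ¬(u.length = 0 ∧ v.length = 0) →
      cutSum u v (fun a b c d => TwoAssocAlgebra.dot (K := K) (h a b) (Q c d)) =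
      cutSum u v (fun a b c d => TwoAssocAlgebra.dot (K := K) (h' a b) (Q c d))) (u v : List R) :
    h u v = h' u v := by
  induction hN : u.length + v.length using Nat.strong_induction_on generalizing u v with
  | _ N ih =>
    by_cases huv : u.length = 0 ∧ v.length = 0
    · rw [List.length_eq_zero_iff.mp huv.1, List.length_eq_zero_iff.mp huv.2, h0]
    · have key := H u v huv
      rw [← sub_eq_zero] at key
      simp only [cutSum, ← Finset.sum_sub_distrib] at key
      rw [Finset.sum_eq_single u.length, Finset.sum_eq_single v.length] at key
      · simp only [if_neg huv, List.take_length, List.drop_length, hQ,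
          TwoAssocAlgebra.dot_one] at key
        exact sub_eq_zero.mp key
      · intro j hj hne
        simp only [Finset.mem_range] at hj
        split_ifs with h1
        · simp
        · rw [ih _ _ (u.take u.length) (v.take j) rfl, sub_self]
          simp only [List.length_take]; omega
      · simp
      · intro i hi hne
        refine Finset.sum_eq_zero fun j hj => ?_
        simp only [Finset.mem_range] at hi hj
        split_ifs with h1
        · simp
        · rw [ih _ _ (u.take i) (v.take j) rfl, sub_self]
          simp only [List.length_take]; omega
      · simp

theorem eq_mPQ_of_cutSum {R : Type*} (f : R → A) (h : List R → List R → A) (h0 : h [] [] = 0)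
    (H : ∀ u v, ¬(u.length = 0 ∧ v.length = 0) →
      cutSum u v (fun a b c d => TwoAssocAlgebra.dot (K := K) (h a b)
        (dotProd K (c.map f) * dotProd K (d.map f))) =
      dotProd K (u.map f) * dotProd K (v.map f)) (u v : List R) :
    h u v = mPQ K (u.map f) (v.map f) := by
  refine cutSum_unique K h (fun u v => mPQ K (u.map f) (v.map f))
    (fun u v => dotProd K (u.map f) * dotProd K (v.map f)) (by simp) (by simp [h0]) ?_ u v
  intro u v huv
  rw [H u v huv, ← cutSum_mPQ K _ _ (by simpa using huv)]
  simp [cutSum, List.map_take, List.map_drop]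

end TwoAssoc

section Infinitesimal

variable (K : Type*) (A : Type*) [Field K] [Ring A] [Algebra K A] [TwoAssocAlgebra K A]

/-- The second product on `A ⊗ A`: `(a ⊗ b) · (a' ⊗ b') = (a · a') ⊗ (b · b')`. -/
noncomputable def tensorDot : A ⊗[K] A →ₗ[K] A ⊗[K] A →ₗ[K] A ⊗[K] A :=
  TensorProduct.map₂ TwoAssocAlgebra.dot TwoAssocAlgebra.dot

variable {A}

@[simp] theorem tensorDot_tmul (a b a' b' : A) :
    tensorDot K A (a ⊗ₜ b) (a' ⊗ₜ b') =
      (TwoAssocAlgebra.dot (K := K) a a') ⊗ₜ (TwoAssocAlgebra.dot (K := K) b b') := rfl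

theorem tensorDot_assoc (x y z : A ⊗[K] A) :
    tensorDot K A (tensorDot K A x y) z = tensorDot K A x (tensorDot K A y z) := by
  induction x with
  | zero => simp
  | add x x' hx hx' => simp [hx, hx']
  | tmul a b =>
    induction y with
    | zero => simp
    | add x x' hx hx' => simp [hx, hx']
    | tmul c d =>
      induction z with
      | zero => simp
      | add x x' hx hx' => rw [map_add, map_add, map_add, hx, hx']
      | tmul e f => simp [TwoAssocAlgebra.dot_assoc]

theorem one_tensorDot (x : A ⊗[K] A) : tensorDot K A (1 ⊗ₜ 1) x = x := by
  induction x with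
  | zero => simp
  | add x x' hx hx' => simp [hx, hx']
  | tmul a b => simp [TwoAssocAlgebra.one_dot]

theorem tensorDot_one (x : A ⊗[K] A) : tensorDot K A x (1 ⊗ₜ 1) = x := by
  induction x with
  | zero => simp
  | add x x' hx hx' => simp [hx, hx']
  | tmul a b => simp [TwoAssocAlgebra.dot_one]

variable (A)

/-- `A × (A ⊗ A)`: the graph of a map `Δ` with `Δ (x * y) = Δ x * Δ y` and
`Δ (x · y) = (x ⊗ 1) · Δ y + Δ x · (1 ⊗ y) - x ⊗ y` is a 2-associative subalgebra of it,
for the componentwise product `*` and the product `·` below. -/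
abbrev UIExt := A × (A ⊗[K] A)

noncomputable instance : TwoAssocAlgebra K (UIExt K A) where
  dot := LinearMap.mk₂ K (fun p q => (TwoAssocAlgebra.dot (K := K) p.1 q.1,
      tensorDot K A (p.1 ⊗ₜ 1) q.2 + tensorDot K A p.2 (1 ⊗ₜ q.1) - p.1 ⊗ₜ q.1))
    (fun p p' q => by
      ext1
      · simp
      · simp [TensorProduct.add_tmul]; abel)
    (fun c p q => by
      ext1
      · simp
      · simp [← TensorProduct.smul_tmul', smul_sub, smul_add])
    (fun p q q' => by
      ext1
      · simp
      · simp [TensorProduct.tmul_add]; abel)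
    (fun c p q => by
      ext1
      · simp
      · simp [TensorProduct.tmul_smul, smul_sub, smul_add])
  dot_assoc x y z := by
    ext1
    · simp [TwoAssocAlgebra.dot_assoc]
    · simp only [LinearMap.mk₂_apply, map_add, map_sub, LinearMap.add_apply, LinearMap.sub_apply,
        tensorDot_assoc, tensorDot_tmul, TwoAssocAlgebra.dot_one,
        TwoAssocAlgebra.one_dot]
      rw [← tensorDot_assoc K _ _ z.2, tensorDot_tmul, TwoAssocAlgebra.dot_one]
      abel
  one_dot x := by
    ext1
    · simp [TwoAssocAlgebra.one_dot]
    · simp [one_tensorDot, Algebra.TensorProduct.one_def, TwoAssocAlgebra.one_dot]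
  dot_one x := by
    ext1
    · simp [TwoAssocAlgebra.dot_one]
    · simp [tensorDot_one, Algebra.TensorProduct.one_def, TwoAssocAlgebra.dot_one]

theorem UIExt.dot_fst (p q : UIExt K A) : (TwoAssocAlgebra.dot (K := K) p q).1 =
    TwoAssocAlgebra.dot (K := K) p.1 q.1 := rfl

theorem UIExt.dot_snd (p q : UIExt K A) : (TwoAssocAlgebra.dot (K := K) p q).2 =
    tensorDot K A (p.1 ⊗ₜ 1) q.2 + tensorDot K A p.2 (1 ⊗ₜ q.1) - p.1 ⊗ₜ q.1 := rfl

/-- `x ↦ (x, x ⊗ 1 + 1 ⊗ x)`. -/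
noncomputable def primExt : A →ₗ[K] UIExt K A where
  toFun x := (x, x ⊗ₜ 1 + 1 ⊗ₜ x)
  map_add' x y := by
    ext1
    · simp
    · simp [TensorProduct.add_tmul, TensorProduct.tmul_add]; abel
  map_smul' c x := by
    ext1
    · simp
    · simp [← TensorProduct.smul_tmul', TensorProduct.tmul_smul]

variable {A}

theorem primExt_dot_snd (x : A) (p : UIExt K A) :
    (TwoAssocAlgebra.dot (K := K) (primExt K A x) p).2 =
      tensorDot K A (x ⊗ₜ 1) p.2 + 1 ⊗ₜ TwoAssocAlgebra.dot (K := K) x p.1 := by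
  rw [UIExt.dot_snd]
  simp only [primExt, LinearMap.coe_mk, AddHom.coe_mk, map_add, LinearMap.add_apply,
    tensorDot_tmul, TwoAssocAlgebra.dot_one, TwoAssocAlgebra.one_dot]
  abel

theorem dotProd_primExt_fst (u : List A) : (dotProd K (u.map (primExt K A))).1 = dotProd K u := by
  induction u with
  | nil => rfl
  | cons x u ih => rw [List.map_cons, dotProd_cons, dotProd_cons, UIExt.dot_fst, ih]; rfl

theorem dotProd_primExt_snd (u : List A) : (dotProd K (u.map (primExt K A))).2 =
    ∑ i ∈ Finset.range (u.length + 1), dotProd K (u.take i) ⊗ₜ dotProd K (u.drop i) := by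
  induction u with
  | nil => simp [Algebra.TensorProduct.one_def]
  | cons x u ih =>
    rw [List.map_cons, dotProd_cons, primExt_dot_snd, ih, dotProd_primExt_fst, List.length_cons,
      Finset.sum_range_succ' _ (u.length + 1)]
    simp [TwoAssocAlgebra.one_dot]

theorem sum_flip {X : Type*} [AddCommMonoid X] (n m : ℕ) (G : ℕ → ℕ → ℕ → ℕ → X) :
    ∑ i ∈ Finset.range (n + 1), ∑ j ∈ Finset.range (m + 1),
      ∑ k ∈ Finset.range (n - i + 1), ∑ l ∈ Finset.range (m - j + 1), G i j k l =
    ∑ s ∈ Finset.range (n + 1), ∑ t ∈ Finset.range (m + 1),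
      ∑ i ∈ Finset.range (s + 1), ∑ j ∈ Finset.range (t + 1), G i j (s - i) (t - j) := by
  have flip : ∀ (n : ℕ) (g : ℕ → ℕ → X), ∑ i ∈ Finset.range (n + 1),
      ∑ k ∈ Finset.range (n - i + 1), g i k =
      ∑ s ∈ Finset.range (n + 1), ∑ i ∈ Finset.range (s + 1), g i (s - i) := by
    intro n g
    rw [Finset.sum_range_diag_flip]
    refine Finset.sum_congr rfl fun i hi => ?_
    simp only [Finset.mem_range] at hi
    rw [show n - i + 1 = n + 1 - i by omega]
  calc _ = ∑ i ∈ Finset.range (n + 1), ∑ k ∈ Finset.range (n - i + 1),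
        ∑ j ∈ Finset.range (m + 1), ∑ l ∈ Finset.range (m - j + 1), G i j k l :=
        Finset.sum_congr rfl fun i _ => Finset.sum_comm
    _ = ∑ i ∈ Finset.range (n + 1), ∑ k ∈ Finset.range (n - i + 1),
        ∑ t ∈ Finset.range (m + 1), ∑ j ∈ Finset.range (t + 1), G i j k (t - j) :=
        Finset.sum_congr rfl fun i _ => Finset.sum_congr rfl fun k _ => flip m _
    _ = _ := by
        rw [flip n (fun i k => ∑ t ∈ Finset.range (m + 1), ∑ j ∈ Finset.range (t + 1),
          G i j k (t - j))]
        refine Finset.sum_congr rfl fun s _ => ?_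
        rw [Finset.sum_comm]

/-- The primitive elements are closed under the operations `M_{pq}`. -/
theorem primExt_mPQ (u v : List A) :
    primExt K A (mPQ K u v) = mPQ K (u.map (primExt K A)) (v.map (primExt K A)) := by
  refine eq_mPQ_of_cutSum K (primExt K A) (fun u v => primExt K A (mPQ K u v)) (by simp) ?_ u v
  intro u v huv
  ext1
  · simp only [cutSum, Prod.fst_sum, Prod.fst_mul, dotProd_primExt_fst]
    rw [← cutSum_mPQ K u v huv]
    refine Finset.sum_congr rfl fun i _ => Finset.sum_congr rfl fun j _ => ?_
    split_ifs
    · rfl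
    · rw [UIExt.dot_fst, Prod.fst_mul, dotProd_primExt_fst, dotProd_primExt_fst]; rfl
  · have hQ : ∀ c d : List A,
        (dotProd K (c.map (primExt K A)) * dotProd K (d.map (primExt K A))).2 =
        ∑ k ∈ Finset.range (c.length + 1), ∑ l ∈ Finset.range (d.length + 1),
          (dotProd K (c.take k) * dotProd K (d.take l)) ⊗ₜ[K]
            (dotProd K (c.drop k) * dotProd K (d.drop l)) := by
      intro c d
      rw [Prod.snd_mul, dotProd_primExt_snd, dotProd_primExt_snd, Finset.sum_mul_sum]
      simp
    rw [hQ]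
    have hL : (cutSum u v (fun a b c d => TwoAssocAlgebra.dot (K := K) (primExt K A (mPQ K a b))
          (dotProd K (c.map (primExt K A)) * dotProd K (d.map (primExt K A))))).2 =
        (∑ i ∈ Finset.range (u.length + 1), ∑ j ∈ Finset.range (v.length + 1),
          ∑ k ∈ Finset.range (u.length - i + 1), ∑ l ∈ Finset.range (v.length - j + 1),
            if i = 0 ∧ j = 0 then 0 else
              (TwoAssocAlgebra.dot (K := K) (mPQ K (u.take i) (v.take j))
                (dotProd K ((u.drop i).take k) * dotProd K ((v.drop j).take l))) ⊗ₜ[K]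
              (dotProd K (u.drop (i + k)) * dotProd K (v.drop (j + l)))) +
        1 ⊗ₜ (dotProd K u * dotProd K v) := by
      rw [← cutSum_mPQ K u v huv]
      simp only [cutSum, Prod.snd_sum, TensorProduct.tmul_sum, ← Finset.sum_add_distrib]
      refine Finset.sum_congr rfl fun i _ => Finset.sum_congr rfl fun j _ => ?_
      split_ifs with h0
      · simp
      · rw [primExt_dot_snd, hQ, Prod.fst_mul, dotProd_primExt_fst, dotProd_primExt_fst]
        simp [TwoAssocAlgebra.one_dot]
    rw [hL, sum_flip u.length v.length (fun i j k l => if i = 0 ∧ j = 0 then 0 else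
              (TwoAssocAlgebra.dot (K := K) (mPQ K (u.take i) (v.take j))
                (dotProd K ((u.drop i).take k) * dotProd K ((v.drop j).take l))) ⊗ₜ[K]
              (dotProd K (u.drop (i + k)) * dotProd K (v.drop (j + l))))]
    have hS : ∀ s ∈ Finset.range (u.length + 1), ∀ t ∈ Finset.range (v.length + 1),
        (∑ i ∈ Finset.range (s + 1), ∑ j ∈ Finset.range (t + 1), if i = 0 ∧ j = 0 then 0 else
              (TwoAssocAlgebra.dot (K := K) (mPQ K (u.take i) (v.take j))
                (dotProd K ((u.drop i).take (s - i)) * dotProd K ((v.drop j).take (t - j)))) ⊗ₜ[K]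
              (dotProd K (u.drop (i + (s - i))) * dotProd K (v.drop (j + (t - j))))) =
        (if s = 0 ∧ t = 0 then 0 else (dotProd K (u.take s) * dotProd K (v.take t)) ⊗ₜ[K]
              (dotProd K (u.drop s) * dotProd K (v.drop t))) := by
      intro s hs t ht
      simp only [Finset.mem_range] at hs ht
      split_ifs with hst
      · simp [hst.1, hst.2]
      · have hus : (u.take s).length = s := by simp only [List.length_take]; omega
        have hvt : (v.take t).length = t := by simp only [List.length_take]; omega
        rw [← cutSum_mPQ K (u.take s) (v.take t) (by rw [hus, hvt]; exact hst)]
        simp only [cutSum, TensorProduct.sum_tmul, hus, hvt]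
        refine Finset.sum_congr rfl fun i hi => Finset.sum_congr rfl fun j hj => ?_
        simp only [Finset.mem_range] at hi hj
        split_ifs with h0
        · simp
        · rw [List.take_take, List.take_take, List.drop_take, List.drop_take,
            min_eq_left (by omega), min_eq_left (by omega),
            show i + (s - i) = s by omega, show j + (t - j) = t by omega]
    rw [Finset.sum_congr rfl fun s hs => Finset.sum_congr rfl fun t ht => hS s hs t ht]
    have h1 : (1 : A) ⊗ₜ[K] (dotProd K u * dotProd K v) =
        ∑ s ∈ Finset.range (u.length + 1), ∑ t ∈ Finset.range (v.length + 1),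
          if s = 0 ∧ t = 0 then (dotProd K (u.take s) * dotProd K (v.take t)) ⊗ₜ[K]
              (dotProd K (u.drop s) * dotProd K (v.drop t)) else 0 := by
      rw [Finset.sum_eq_single 0, Finset.sum_eq_single 0]
      · simp
      · intro t _ ht; simp [ht]
      · simp
      · intro s _ hs; simp [hs]
      · simp
    rw [h1]
    simp only [← Finset.sum_add_distrib]
    refine Finset.sum_congr rfl fun s _ => Finset.sum_congr rfl fun t _ => ?_
    split_ifs <;> simp

section Coassoc

variable (Δ : A →ₗ[K] A ⊗[K] A)

/-- The unital infinitesimal relation between the product `·` and `Δ`. -/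
def IsUnitalInfinitesimal : Prop := ∀ x y : A, Δ (TwoAssocAlgebra.dot (K := K) x y) =
  tensorDot K A (x ⊗ₜ 1) (Δ y) + tensorDot K A (Δ x) (1 ⊗ₜ y) - x ⊗ₜ y

variable (A) in
/-- The product `·` on `A ⊗ (A ⊗ A)`. -/
noncomputable def tensorDot₃ :
    A ⊗[K] (A ⊗[K] A) →ₗ[K] A ⊗[K] (A ⊗[K] A) →ₗ[K] A ⊗[K] (A ⊗[K] A) :=
  TensorProduct.map₂ TwoAssocAlgebra.dot (tensorDot K A)

@[simp] theorem tensorDot₃_tmul (a a' : A) (s s' : A ⊗[K] A) :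
    tensorDot₃ K A (a ⊗ₜ s) (a' ⊗ₜ s') =
      (TwoAssocAlgebra.dot (K := K) a a') ⊗ₜ (tensorDot K A s s') := rfl

theorem assoc_left_dot (x b : A) (s : A ⊗[K] A) :
    TensorProduct.assoc K A A A (tensorDot K A (x ⊗ₜ 1) s ⊗ₜ b) =
      tensorDot₃ K A (x ⊗ₜ (1 ⊗ₜ 1)) (TensorProduct.assoc K A A A (s ⊗ₜ b)) := by
  induction s with
  | zero => simp
  | add s s' h h' => simp only [map_add, TensorProduct.add_tmul, h, h']
  | tmul c d => simp [TwoAssocAlgebra.one_dot]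

theorem assoc_right_dot (a b : A) (s : A ⊗[K] A) :
    TensorProduct.assoc K A A A (tensorDot K A s (1 ⊗ₜ a) ⊗ₜ b) =
      tensorDot₃ K A (TensorProduct.assoc K A A A (s ⊗ₜ 1)) (1 ⊗ₜ (a ⊗ₜ b)) := by
  induction s with
  | zero => simp
  | add s s' h h' => simp only [map_add, TensorProduct.add_tmul, LinearMap.add_apply, h, h']
  | tmul c d => simp [TwoAssocAlgebra.one_dot, TwoAssocAlgebra.dot_one]

variable {K Δ}

theorem IsUnitalInfinitesimal.coassoc_dot (hΔ : IsUnitalInfinitesimal K Δ) (x y : A)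
    (hx : TensorProduct.assoc K A A A (Δ.rTensor A (Δ x)) = Δ.lTensor A (Δ x))
    (hy : TensorProduct.assoc K A A A (Δ.rTensor A (Δ y)) = Δ.lTensor A (Δ y)) :
    TensorProduct.assoc K A A A (Δ.rTensor A (Δ (TwoAssocAlgebra.dot (K := K) x y))) =
      Δ.lTensor A (Δ (TwoAssocAlgebra.dot (K := K) x y)) := by
  have h1 : ∀ t : A ⊗[K] A,
      TensorProduct.assoc K A A A (Δ.rTensor A (tensorDot K A (x ⊗ₜ 1) t)) =
        tensorDot₃ K A (x ⊗ₜ (1 ⊗ₜ 1)) (TensorProduct.assoc K A A A (Δ.rTensor A t)) +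
        tensorDot₃ K A (TensorProduct.assoc K A A A (Δ x ⊗ₜ 1)) (1 ⊗ₜ t) - x ⊗ₜ t := by
    intro t
    induction t with
    | zero => simp
    | add s s' h h' => simp only [map_add, TensorProduct.tmul_add, h, h']; abel
    | tmul a b =>
      rw [tensorDot_tmul, LinearMap.rTensor_tmul, hΔ, TensorProduct.sub_tmul,
        TensorProduct.add_tmul, map_sub, map_add, TwoAssocAlgebra.one_dot, assoc_left_dot,
        assoc_right_dot, TensorProduct.assoc_tmul, LinearMap.rTensor_tmul]
  have h2 : ∀ t : A ⊗[K] A,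
      TensorProduct.assoc K A A A (Δ.rTensor A (tensorDot K A t (1 ⊗ₜ y))) =
        tensorDot₃ K A (TensorProduct.assoc K A A A (Δ.rTensor A t)) (1 ⊗ₜ (1 ⊗ₜ y)) := by
    intro t
    induction t with
    | zero => simp
    | add s s' h h' => simp only [map_add, LinearMap.add_apply, h, h']
    | tmul a b =>
      rw [tensorDot_tmul, LinearMap.rTensor_tmul, LinearMap.rTensor_tmul,
        TwoAssocAlgebra.dot_one]
      generalize Δ a = s
      induction s with
      | zero => simp
      | add s s' h h' => simp only [map_add, TensorProduct.add_tmul, LinearMap.add_apply, h, h']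
      | tmul c d => simp [TwoAssocAlgebra.dot_one]
  have h3 : ∀ t : A ⊗[K] A, Δ.lTensor A (tensorDot K A (x ⊗ₜ 1) t) =
      tensorDot₃ K A (x ⊗ₜ (1 ⊗ₜ 1)) (Δ.lTensor A t) := by
    intro t
    induction t with
    | zero => simp
    | add s s' h h' => simp only [map_add, h, h']
    | tmul a b =>
      rw [tensorDot_tmul, LinearMap.lTensor_tmul, LinearMap.lTensor_tmul, tensorDot₃_tmul,
        TwoAssocAlgebra.one_dot, one_tensorDot]
  have h4 : ∀ t : A ⊗[K] A, Δ.lTensor A (tensorDot K A t (1 ⊗ₜ y)) =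
      tensorDot₃ K A (TensorProduct.assoc K A A A (t ⊗ₜ 1)) (1 ⊗ₜ Δ y) +
        tensorDot₃ K A (Δ.lTensor A t) (1 ⊗ₜ (1 ⊗ₜ y)) -
        TensorProduct.assoc K A A A (t ⊗ₜ y) := by
    intro t
    induction t with
    | zero => simp
    | add s s' h h' => simp only [map_add, TensorProduct.add_tmul, LinearMap.add_apply, h, h']; abel
    | tmul a b =>
      rw [tensorDot_tmul, LinearMap.lTensor_tmul, hΔ, TensorProduct.tmul_sub,
        TensorProduct.tmul_add, TwoAssocAlgebra.dot_one, LinearMap.lTensor_tmul,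
        TensorProduct.assoc_tmul, TensorProduct.assoc_tmul, tensorDot₃_tmul, tensorDot₃_tmul,
        TwoAssocAlgebra.dot_one]
  rw [hΔ, map_sub, map_sub, map_add, map_add, map_sub, map_add, h1, h2, h3, h4,
    LinearMap.rTensor_tmul, LinearMap.lTensor_tmul, hx, hy]
  abel

variable {ε : A →ₗ[K] K}

theorem IsUnitalInfinitesimal.rTensor_counit_dot (hΔ : IsUnitalInfinitesimal K Δ)
    (hε : ∀ x y, ε (TwoAssocAlgebra.dot (K := K) x y) = ε x * ε y) (x y : A)
    (hx : ε.rTensor A (Δ x) = 1 ⊗ₜ x) (hy : ε.rTensor A (Δ y) = 1 ⊗ₜ y) :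
    ε.rTensor A (Δ (TwoAssocAlgebra.dot (K := K) x y)) =
      1 ⊗ₜ TwoAssocAlgebra.dot (K := K) x y := by
  have e1 : ∀ t : A ⊗[K] A, ε.rTensor A (tensorDot K A (x ⊗ₜ 1) t) = ε x • ε.rTensor A t := by
    intro t
    induction t with
    | zero => simp
    | add s s' h h' => simp only [map_add, smul_add, h, h']
    | tmul a b => simp [hε, TwoAssocAlgebra.one_dot, TensorProduct.smul_tmul']
  have e2 : ∀ t : A ⊗[K] A, ε.rTensor A (tensorDot K A t (1 ⊗ₜ y)) =
      (TwoAssocAlgebra.dot.flip y).lTensor K (ε.rTensor A t) := by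
    intro t
    induction t with
    | zero => simp
    | add s s' h h' => simp only [map_add, LinearMap.add_apply, h, h']
    | tmul a b => simp [TwoAssocAlgebra.dot_one]
  rw [hΔ, map_sub, map_add, e1, e2, hx, hy]
  simp [TensorProduct.smul_tmul']

theorem IsUnitalInfinitesimal.lTensor_counit_dot (hΔ : IsUnitalInfinitesimal K Δ)
    (hε : ∀ x y, ε (TwoAssocAlgebra.dot (K := K) x y) = ε x * ε y) (x y : A)
    (hx : ε.lTensor A (Δ x) = x ⊗ₜ 1) (hy : ε.lTensor A (Δ y) = y ⊗ₜ 1) :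
    ε.lTensor A (Δ (TwoAssocAlgebra.dot (K := K) x y)) =
      TwoAssocAlgebra.dot (K := K) x y ⊗ₜ 1 := by
  have e1 : ∀ t : A ⊗[K] A, ε.lTensor A (tensorDot K A t (1 ⊗ₜ y)) = ε y • ε.lTensor A t := by
    intro t
    induction t with
    | zero => simp
    | add s s' h h' => simp only [map_add, smul_add, LinearMap.add_apply, h, h']
    | tmul a b => simp [hε, TwoAssocAlgebra.dot_one, mul_comm, ← TensorProduct.tmul_smul]
  have e2 : ∀ t : A ⊗[K] A, ε.lTensor A (tensorDot K A (x ⊗ₜ 1) t) =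
      (TwoAssocAlgebra.dot x).rTensor K (ε.lTensor A t) := by
    intro t
    induction t with
    | zero => simp
    | add s s' h h' => simp only [map_add, h, h']
    | tmul a b => simp [TwoAssocAlgebra.one_dot]
  rw [hΔ, map_sub, map_add, e1, e2, hx, hy]
  simp [← TensorProduct.tmul_smul]

end Coassoc

end Infinitesimal

section Free

/-- Formal expressions in vectors of `V`, scalars, a sum and two products. -/
inductive FreeTwoAssoc.Pre (K V : Type*)
  | of : V → FreeTwoAssoc.Pre K V
  | scalar : K → FreeTwoAssoc.Pre K V
  | add : FreeTwoAssoc.Pre K V → FreeTwoAssoc.Pre K V → FreeTwoAssoc.Pre K V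
  | mul : FreeTwoAssoc.Pre K V → FreeTwoAssoc.Pre K V → FreeTwoAssoc.Pre K V
  | dot : FreeTwoAssoc.Pre K V → FreeTwoAssoc.Pre K V → FreeTwoAssoc.Pre K V

open FreeTwoAssoc.Pre in
/-- The relations forcing the quotient to be a 2-associative algebra in which scalars act by
`c • x = scalar c * x`, and `of` to be linear. -/
inductive FreeTwoAssoc.Rel (K V : Type*) [Field K] [AddCommGroup V] [Module K V] :
    FreeTwoAssoc.Pre K V → FreeTwoAssoc.Pre K V → Prop
  | of_add (v w : V) : Rel K V (of (v + w)) (add (of v) (of w))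
  | of_smul (c : K) (v : V) : Rel K V (of (c • v)) (mul (scalar c) (of v))
  | add_scalar (c d : K) : Rel K V (scalar (c + d)) (add (scalar c) (scalar d))
  | mul_scalar (c d : K) : Rel K V (scalar (c * d)) (mul (scalar c) (scalar d))
  | central_scalar (c : K) (a) : Rel K V (mul (scalar c) a) (mul a (scalar c))
  | add_assoc (a b c) : Rel K V (add (add a b) c) (add a (add b c))
  | add_comm (a b) : Rel K V (add a b) (add b a)
  | zero_add (a) : Rel K V (add (scalar 0) a) a
  | mul_assoc (a b c) : Rel K V (mul (mul a b) c) (mul a (mul b c))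
  | one_mul (a) : Rel K V (mul (scalar 1) a) a
  | mul_one (a) : Rel K V (mul a (scalar 1)) a
  | left_distrib (a b c) : Rel K V (mul a (add b c)) (add (mul a b) (mul a c))
  | right_distrib (a b c) : Rel K V (mul (add a b) c) (add (mul a c) (mul b c))
  | zero_mul (a) : Rel K V (mul (scalar 0) a) (scalar 0)
  | mul_zero (a) : Rel K V (mul a (scalar 0)) (scalar 0)
  | dot_assoc (a b c) : Rel K V (dot (dot a b) c) (dot a (dot b c))
  | one_dot (a) : Rel K V (dot (scalar 1) a) a
  | dot_one (a) : Rel K V (dot a (scalar 1)) a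
  | dot_add (a b c) : Rel K V (dot a (add b c)) (add (dot a b) (dot a c))
  | add_dot (a b c) : Rel K V (dot (add a b) c) (add (dot a c) (dot b c))
  | smul_dot (c : K) (a b) : Rel K V (dot (mul (scalar c) a) b) (mul (scalar c) (dot a b))
  | dot_smul (c : K) (a b) : Rel K V (dot a (mul (scalar c) b)) (mul (scalar c) (dot a b))
  | add_left (a b c) : Rel K V a b → Rel K V (add a c) (add b c)
  | add_right (a b c) : Rel K V a b → Rel K V (add c a) (add c b)
  | mul_left (a b c) : Rel K V a b → Rel K V (mul a c) (mul b c)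
  | mul_right (a b c) : Rel K V a b → Rel K V (mul c a) (mul c b)
  | dot_left (a b c) : Rel K V a b → Rel K V (dot a c) (dot b c)
  | dot_right (a b c) : Rel K V a b → Rel K V (dot c a) (dot c b)

variable (K V : Type*) [Field K] [AddCommGroup V] [Module K V]

/-- The free 2-associative algebra `2as(V)` on the vector space `V`. -/
def FreeTwoAssoc := Quot (FreeTwoAssoc.Rel K V)

namespace FreeTwoAssoc

instance : Zero (FreeTwoAssoc K V) := ⟨Quot.mk _ (.scalar 0)⟩

instance : One (FreeTwoAssoc K V) := ⟨Quot.mk _ (.scalar 1)⟩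

instance : Add (FreeTwoAssoc K V) :=
  ⟨Quot.map₂ .add (fun _ _ _ => Rel.add_right _ _ _) (fun _ _ _ => Rel.add_left _ _ _)⟩

instance : Mul (FreeTwoAssoc K V) :=
  ⟨Quot.map₂ .mul (fun _ _ _ => Rel.mul_right _ _ _) (fun _ _ _ => Rel.mul_left _ _ _)⟩

instance : Neg (FreeTwoAssoc K V) :=
  ⟨Quot.map (.mul (.scalar (-1))) (fun _ _ => Rel.mul_right _ _ _)⟩

instance : Ring (FreeTwoAssoc K V) where
  add_assoc := by rintro ⟨a⟩ ⟨b⟩ ⟨c⟩; exact Quot.sound (Rel.add_assoc _ _ _)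
  zero_add := by rintro ⟨a⟩; exact Quot.sound (Rel.zero_add _)
  add_zero := by
    rintro ⟨a⟩
    exact (Quot.sound (Rel.add_comm _ _)).trans (Quot.sound (Rel.zero_add _))
  add_comm := by rintro ⟨a⟩ ⟨b⟩; exact Quot.sound (Rel.add_comm _ _)
  mul_assoc := by rintro ⟨a⟩ ⟨b⟩ ⟨c⟩; exact Quot.sound (Rel.mul_assoc _ _ _)
  one_mul := by rintro ⟨a⟩; exact Quot.sound (Rel.one_mul _)
  mul_one := by rintro ⟨a⟩; exact Quot.sound (Rel.mul_one _)
  left_distrib := by rintro ⟨a⟩ ⟨b⟩ ⟨c⟩; exact Quot.sound (Rel.left_distrib _ _ _)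
  right_distrib := by rintro ⟨a⟩ ⟨b⟩ ⟨c⟩; exact Quot.sound (Rel.right_distrib _ _ _)
  zero_mul := by rintro ⟨a⟩; exact Quot.sound (Rel.zero_mul _)
  mul_zero := by rintro ⟨a⟩; exact Quot.sound (Rel.mul_zero _)
  neg_add_cancel := by
    rintro ⟨a⟩
    calc (Quot.mk _ (.add (.mul (.scalar (-1)) a) a) : FreeTwoAssoc K V)
        = Quot.mk _ (.add (.mul (.scalar (-1)) a) (.mul (.scalar 1) a)) :=
          (Quot.sound (Rel.add_right _ _ _ (Rel.one_mul a))).symm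
      _ = Quot.mk _ (.mul (.add (.scalar (-1)) (.scalar 1)) a) :=
          (Quot.sound (Rel.right_distrib _ _ _)).symm
      _ = Quot.mk _ (.mul (.scalar (-1 + 1)) a) :=
          (Quot.sound (Rel.mul_left _ _ _ (Rel.add_scalar _ _))).symm
      _ = Quot.mk _ (.scalar 0) := by
          rw [neg_add_cancel]; exact Quot.sound (Rel.zero_mul _)
  nsmul := nsmulRec
  zsmul := zsmulRec

instance : Algebra K (FreeTwoAssoc K V) where
  smul c := Quot.map (.mul (.scalar c)) (fun _ _ => Rel.mul_right _ _ _)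
  algebraMap :=
    { toFun := fun c => Quot.mk _ (.scalar c)
      map_one' := rfl
      map_zero' := rfl
      map_add' := fun _ _ => Quot.sound (Rel.add_scalar _ _)
      map_mul' := fun _ _ => Quot.sound (Rel.mul_scalar _ _) }
  commutes' := by rintro c ⟨a⟩; exact Quot.sound (Rel.central_scalar _ _)
  smul_def' := by rintro c ⟨a⟩; rfl

noncomputable instance : TwoAssocAlgebra K (FreeTwoAssoc K V) where
  dot := LinearMap.mk₂ K
    (Quot.map₂ .dot (fun _ _ _ => Rel.dot_right _ _ _) (fun _ _ _ => Rel.dot_left _ _ _))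
    (by rintro ⟨a⟩ ⟨b⟩ ⟨c⟩; exact Quot.sound (Rel.add_dot _ _ _))
    (by rintro c ⟨a⟩ ⟨b⟩; exact Quot.sound (Rel.smul_dot _ _ _))
    (by rintro ⟨a⟩ ⟨b⟩ ⟨c⟩; exact Quot.sound (Rel.dot_add _ _ _))
    (by rintro c ⟨a⟩ ⟨b⟩; exact Quot.sound (Rel.dot_smul _ _ _))
  dot_assoc := by rintro ⟨a⟩ ⟨b⟩ ⟨c⟩; exact Quot.sound (Rel.dot_assoc _ _ _)
  one_dot := by rintro ⟨a⟩; exact Quot.sound (Rel.one_dot _)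
  dot_one := by rintro ⟨a⟩; exact Quot.sound (Rel.dot_one _)

/-- The inclusion `V → 2as(V)`. -/
def ι : V →ₗ[K] FreeTwoAssoc K V where
  toFun v := Quot.mk _ (.of v)
  map_add' _ _ := Quot.sound (Rel.of_add _ _)
  map_smul' _ _ := Quot.sound (Rel.of_smul _ _)

variable {K V}

theorem induction {P : FreeTwoAssoc K V → Prop} (hι : ∀ v, P (ι K V v))
    (hs : ∀ c, P (algebraMap K _ c)) (ha : ∀ x y, P x → P y → P (x + y))
    (hm : ∀ x y, P x → P y → P (x * y))
    (hd : ∀ x y, P x → P y → P (TwoAssocAlgebra.dot (K := K) x y)) (x) : P x := by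
  obtain ⟨a⟩ := x
  induction a with
  | of v => exact hι v
  | scalar c => exact hs c
  | add a b iha ihb => exact ha _ _ iha ihb
  | mul a b iha ihb => exact hm _ _ iha ihb
  | dot a b iha ihb => exact hd _ _ iha ihb

variable {B : Type*} [Ring B] [Algebra K B] [TwoAssocAlgebra K B]

/-- Evaluation of a formal expression in a 2-associative algebra. -/
def liftFun (f : V →ₗ[K] B) : Pre K V → B
  | .of v => f v
  | .scalar c => algebraMap K B c
  | .add a b => liftFun f a + liftFun f b
  | .mul a b => liftFun f a * liftFun f b
  | .dot a b => TwoAssocAlgebra.dot (K := K) (liftFun f a) (liftFun f b)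

/-- The extension of a linear map `V → B` to `2as(V)`. -/
def lift (f : V →ₗ[K] B) : FreeTwoAssoc K V →ₐ[K] B where
  toFun := Quot.lift (liftFun f) (by
    intro a b h
    induction h with
    | of_add => simp [liftFun]
    | of_smul => simp [liftFun, Algebra.smul_def]
    | add_scalar => simp [liftFun]
    | mul_scalar => simp [liftFun]
    | central_scalar => simp only [liftFun]; exact Algebra.commutes _ _
    | add_assoc => simp only [liftFun]; exact _root_.add_assoc _ _ _
    | add_comm => simp only [liftFun]; exact _root_.add_comm _ _
    | zero_add => simp [liftFun]
    | mul_assoc => simp only [liftFun]; exact _root_.mul_assoc _ _ _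
    | one_mul => simp [liftFun]
    | mul_one => simp [liftFun]
    | left_distrib => simp only [liftFun]; exact mul_add _ _ _
    | right_distrib => simp only [liftFun]; exact add_mul _ _ _
    | zero_mul => simp [liftFun]
    | mul_zero => simp [liftFun]
    | dot_assoc => simp only [liftFun]; exact TwoAssocAlgebra.dot_assoc _ _ _
    | one_dot => simp [liftFun, TwoAssocAlgebra.one_dot]
    | dot_one => simp [liftFun, TwoAssocAlgebra.dot_one]
    | dot_add => simp [liftFun]
    | add_dot => simp [liftFun]
    | smul_dot => simp only [liftFun, ← Algebra.smul_def]; simp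
    | dot_smul => simp only [liftFun, ← Algebra.smul_def]; simp
    | add_left _ _ _ _ ih => simp only [liftFun, ih]
    | add_right _ _ _ _ ih => simp only [liftFun, ih]
    | mul_left _ _ _ _ ih => simp only [liftFun, ih]
    | mul_right _ _ _ _ ih => simp only [liftFun, ih]
    | dot_left _ _ _ _ ih => simp only [liftFun, ih]
    | dot_right _ _ _ _ ih => simp only [liftFun, ih])
  map_one' := (algebraMap K B).map_one
  map_mul' := by rintro ⟨a⟩ ⟨b⟩; rfl
  map_zero' := (algebraMap K B).map_zero
  map_add' := by rintro ⟨a⟩ ⟨b⟩; rfl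
  commutes' _ := rfl

@[simp] theorem lift_ι (f : V →ₗ[K] B) (v : V) : lift f (ι K V v) = f v := rfl

theorem lift_dot (f : V →ₗ[K] B) (x y : FreeTwoAssoc K V) :
    lift f (TwoAssocAlgebra.dot (K := K) x y) =
      TwoAssocAlgebra.dot (K := K) (lift f x) (lift f y) := by
  obtain ⟨a⟩ := x
  obtain ⟨b⟩ := y
  rfl

end FreeTwoAssoc

section Hom

variable {K} {A B : Type*} [Ring A] [Algebra K A] [TwoAssocAlgebra K A]
  [Ring B] [Algebra K B] [TwoAssocAlgebra K B]

theorem map_dotProd (φ : A →ₐ[K] B) (hφ : ∀ x y, φ (TwoAssocAlgebra.dot (K := K) x y) =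
    TwoAssocAlgebra.dot (K := K) (φ x) (φ y)) (u : List A) :
    φ (dotProd K u) = dotProd K (u.map φ) := by
  induction u with
  | nil => simp
  | cons x u ih => rw [List.map_cons, dotProd_cons, dotProd_cons, hφ, ih]

theorem map_mPQ (φ : A →ₐ[K] B) (hφ : ∀ x y, φ (TwoAssocAlgebra.dot (K := K) x y) =
    TwoAssocAlgebra.dot (K := K) (φ x) (φ y)) (u v : List A) :
    φ (mPQ K u v) = mPQ K (u.map φ) (v.map φ) := by
  refine eq_mPQ_of_cutSum K φ (fun u v => φ (mPQ K u v)) (by simp) ?_ u v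
  intro u v huv
  simp only [← map_dotProd φ hφ, ← hφ, ← map_mul]
  rw [← cutSum_mPQ K u v huv]
  simp only [cutSum, map_sum]
  refine Finset.sum_congr rfl fun i _ => Finset.sum_congr rfl fun j _ => ?_
  split_ifs <;> simp

end Hom

end Free

section Enveloping

variable (K R : Type*) [Field K] [AddCommGroup R] [Module K R] [BInfinityAlgebra K R]

/-- The congruence `≈` on `2as(R)`: the smallest equivalence relation compatible with the sum and
both products such that `M_{pq}(r₁ ⋯ r_p, s₁ ⋯ s_q)`, computed in `R`, is equivalent to
`M_{pq}(r₁ ⋯ r_p, s₁ ⋯ s_q)`, computed in `2as(R)`. -/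
def U2.con : RingCon (FreeTwoAssoc K R) :=
  sInf {c | (∀ u v : List R, c (FreeTwoAssoc.ι K R (BInfinityAlgebra.op K u v))
      (mPQ K (u.map (FreeTwoAssoc.ι K R)) (v.map (FreeTwoAssoc.ι K R)))) ∧
    ∀ a a' b b', c a a' → c b b' →
      c (TwoAssocAlgebra.dot (K := K) a b) (TwoAssocAlgebra.dot (K := K) a' b')}

theorem U2.con_iff (x y : FreeTwoAssoc K R) : U2.con K R x y ↔ ∀ c : RingCon (FreeTwoAssoc K R),
    (∀ u v : List R, c (FreeTwoAssoc.ι K R (BInfinityAlgebra.op K u v))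
      (mPQ K (u.map (FreeTwoAssoc.ι K R)) (v.map (FreeTwoAssoc.ι K R)))) →
    (∀ a a' b b', c a a' → c b b' →
      c (TwoAssocAlgebra.dot (K := K) a b) (TwoAssocAlgebra.dot (K := K) a' b')) → c x y :=
  ⟨fun h c h1 h2 => h c ⟨h1, h2⟩, fun h c hc => h c hc.1 hc.2⟩

/-- The universal enveloping 2-associative algebra `U2(R) = 2as(R) / ≈` of a `B_∞`-algebra. -/
def U2 := (U2.con K R).Quotient

namespace U2

instance : Ring (U2 K R) := inferInstanceAs (Ring (U2.con K R).Quotient)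

instance : Algebra K (U2 K R) := inferInstanceAs (Algebra K (U2.con K R).Quotient)

/-- The projection `2as(R) → U2(R)`. -/
def mk : FreeTwoAssoc K R →ₐ[K] U2 K R where
  toFun x := (x : (U2.con K R).Quotient)
  map_one' := rfl
  map_mul' _ _ := rfl
  map_zero' := rfl
  map_add' _ _ := rfl
  commutes' _ := rfl

theorem mk_surjective : Function.Surjective (mk K R) := Quotient.mk_surjective

theorem mk_eq_mk (x y : FreeTwoAssoc K R) : mk K R x = mk K R y ↔ U2.con K R x y :=
  (U2.con K R).eq

noncomputable instance : TwoAssocAlgebra K (U2 K R) where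
  dot := LinearMap.mk₂ K
    (Quotient.map₂ (fun x y => TwoAssocAlgebra.dot (K := K) x y) (by
      intro a a' h b b' h'
      change U2.con K R _ _
      rw [con_iff]
      intro c h1 h2
      exact h2 _ _ _ _ ((con_iff K R _ _).mp h c h1 h2) ((con_iff K R _ _).mp h' c h1 h2)))
    (by rintro ⟨a⟩ ⟨b⟩ ⟨c⟩; exact congrArg (mk K R) (by simp))
    (by rintro c ⟨a⟩ ⟨b⟩; exact congrArg (mk K R) (by simp))
    (by rintro ⟨a⟩ ⟨b⟩ ⟨c⟩; exact congrArg (mk K R) (by simp))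
    (by rintro c ⟨a⟩ ⟨b⟩; exact congrArg (mk K R) (by simp))
  dot_assoc := by
    rintro ⟨a⟩ ⟨b⟩ ⟨c⟩; exact congrArg (mk K R) (TwoAssocAlgebra.dot_assoc _ _ _)
  one_dot := by rintro ⟨a⟩; exact congrArg (mk K R) (TwoAssocAlgebra.one_dot _)
  dot_one := by rintro ⟨a⟩; exact congrArg (mk K R) (TwoAssocAlgebra.dot_one _)

theorem mk_dot (x y : FreeTwoAssoc K R) : mk K R (TwoAssocAlgebra.dot (K := K) x y) =
    TwoAssocAlgebra.dot (K := K) (mk K R x) (mk K R y) := rfl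

/-- The canonical map `R → U2(R)`. -/
def ι : R →ₗ[K] U2 K R := (mk K R).toLinearMap ∘ₗ FreeTwoAssoc.ι K R

theorem ι_op (u v : List R) : ι K R (BInfinityAlgebra.op K u v) =
    mPQ K (u.map (ι K R)) (v.map (ι K R)) := by
  have h := map_mPQ (mk K R) (mk_dot K R)
    (u.map (FreeTwoAssoc.ι K R)) (v.map (FreeTwoAssoc.ι K R))
  rw [List.map_map, List.map_map] at h
  refine Eq.trans ?_ h
  exact (mk_eq_mk K R _ _).mpr ((con_iff K R _ _).mpr fun c h1 _ => h1 u v)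

variable {K R}

theorem induction {P : U2 K R → Prop} (hι : ∀ v, P (ι K R v))
    (hs : ∀ c, P (algebraMap K _ c)) (ha : ∀ x y, P x → P y → P (x + y))
    (hm : ∀ x y, P x → P y → P (x * y))
    (hd : ∀ x y, P x → P y → P (TwoAssocAlgebra.dot (K := K) x y)) (x) : P x := by
  obtain ⟨x, rfl⟩ := mk_surjective K R x
  induction x using FreeTwoAssoc.induction with
  | hι v => exact hι v
  | hs c => exact hs c
  | ha x y hx hy => rw [map_add]; exact ha _ _ hx hy
  | hm x y hx hy => rw [map_mul]; exact hm _ _ hx hy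
  | hd x y hx hy => rw [mk_dot]; exact hd _ _ hx hy

variable {B : Type*} [Ring B] [Algebra K B] [TwoAssocAlgebra K B]

/-- The extension of a `B_∞`-morphism `R → B` to `U2(R)`. -/
def lift (f : R →ₗ[K] B)
    (hf : ∀ u v : List R, f (BInfinityAlgebra.op K u v) = mPQ K (u.map f) (v.map f)) :
    U2 K R →ₐ[K] B where
  toFun := Quotient.lift (FreeTwoAssoc.lift f) (by
    intro x y h
    refine (con_iff K R x y).mp h (RingCon.ker (FreeTwoAssoc.lift f).toRingHom) ?_ ?_
    · intro u v
      change FreeTwoAssoc.lift f _ = FreeTwoAssoc.lift f _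
      rw [map_mPQ _ (FreeTwoAssoc.lift_dot f), FreeTwoAssoc.lift_ι, hf, List.map_map, List.map_map]
      rfl
    · intro a a' b b' h1 h2
      change FreeTwoAssoc.lift f _ = FreeTwoAssoc.lift f _ at *
      rw [FreeTwoAssoc.lift_dot, FreeTwoAssoc.lift_dot, h1, h2])
  map_one' := map_one (FreeTwoAssoc.lift f)
  map_mul' := by rintro ⟨a⟩ ⟨b⟩; exact map_mul (FreeTwoAssoc.lift f) a b
  map_zero' := map_zero (FreeTwoAssoc.lift f)
  map_add' := by rintro ⟨a⟩ ⟨b⟩; exact map_add (FreeTwoAssoc.lift f) a b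
  commutes' c := (FreeTwoAssoc.lift f).commutes c

theorem lift_ι (f : R →ₗ[K] B) (hf) (r : R) : lift f hf (ι K R r) = f r := rfl

theorem lift_dot (f : R →ₗ[K] B) (hf) (x y : U2 K R) :
    lift f hf (TwoAssocAlgebra.dot (K := K) x y) =
      TwoAssocAlgebra.dot (K := K) (lift f hf x) (lift f hf y) := by
  obtain ⟨a, rfl⟩ := mk_surjective K R x
  obtain ⟨b, rfl⟩ := mk_surjective K R y
  exact FreeTwoAssoc.lift_dot f a b


section Comul

variable (K R)

/-- `x ↦ (x, Δ x)`. -/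
noncomputable def comulAux : U2 K R →ₐ[K] UIExt K (U2 K R) :=
  lift (primExt K (U2 K R) ∘ₗ ι K R) (fun u v => by
    rw [LinearMap.comp_apply, ι_op, primExt_mPQ, List.map_map, List.map_map]
    rfl)

theorem comulAux_dot (x y : U2 K R) :
    comulAux K R (TwoAssocAlgebra.dot (K := K) x y) =
      TwoAssocAlgebra.dot (K := K) (comulAux K R x) (comulAux K R y) :=
  lift_dot _ _ x y

theorem comulAux_fst (x : U2 K R) : (comulAux K R x).1 = x := by
  induction x using U2.induction with
  | hι v => rfl
  | hs c => rw [AlgHom.commutes]; rfl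
  | ha x y hx hy => rw [map_add, Prod.fst_add, hx, hy]
  | hm x y hx hy => rw [map_mul, Prod.fst_mul, hx, hy]
  | hd x y hx hy => rw [comulAux_dot, UIExt.dot_fst, hx, hy]

/-- The coproduct of `U2(R)`: the unique map with `Δ (ι r) = ι r ⊗ 1 + 1 ⊗ ι r`, which is
multiplicative for `*` and satisfies the unital infinitesimal relation for `·`
(see `comulAlgHom_ι` and `isUnitalInfinitesimal` below). -/
noncomputable def comulAlgHom : U2 K R →ₐ[K] U2 K R ⊗[K] U2 K R :=
  (AlgHom.snd K (U2 K R) (U2 K R ⊗[K] U2 K R)).comp (comulAux K R)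

theorem comulAlgHom_ι (r : R) : comulAlgHom K R (ι K R r) = ι K R r ⊗ₜ 1 + 1 ⊗ₜ ι K R r := rfl

theorem isUnitalInfinitesimal : IsUnitalInfinitesimal K (comulAlgHom K R).toLinearMap := by
  intro x y
  change (comulAux K R _).2 = _
  rw [comulAux_dot, UIExt.dot_snd, comulAux_fst, comulAux_fst]
  rfl

/-- The counit of `U2(R)`, multiplicative for both products and zero on `R`. -/
noncomputable def counitAlgHom : U2 K R →ₐ[K] K :=
  lift 0 (fun u v => eq_mPQ_of_cutSum K (0 : R →ₗ[K] K) (fun _ _ => 0) rfl (by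
    intro u v huv
    have h0 : ∀ w : List R, w.length ≠ 0 → dotProd K (w.map (0 : R →ₗ[K] K)) = 0 := by
      intro w hw
      cases w with
      | nil => simp at hw
      | cons x w => simp
    have : dotProd K (u.map (0 : R →ₗ[K] K)) * dotProd K (v.map (0 : R →ₗ[K] K)) = 0 := by
      by_cases hu : u.length = 0
      · rw [h0 v (by omega), mul_zero]
      · rw [h0 u hu, zero_mul]
    rw [this]
    simp [cutSum]) u v)

theorem counitAlgHom_ι (r : R) : counitAlgHom K R (ι K R r) = 0 := rfl

theorem counitAlgHom_dot (x y : U2 K R) : (counitAlgHom K R).toLinearMap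
    (TwoAssocAlgebra.dot (K := K) x y) = counitAlgHom K R x * counitAlgHom K R y :=
  lift_dot _ _ x y

/-- `U2(R)` as a bialgebra, with the product `*`. -/
noncomputable instance : Bialgebra K (U2 K R) :=
  Bialgebra.ofAlgHom (comulAlgHom K R) (counitAlgHom K R)
    (by
      ext x
      induction x using U2.induction with
      | hι r =>
        simp [comulAlgHom_ι, TensorProduct.add_tmul, TensorProduct.tmul_add,
          Algebra.TensorProduct.one_def]
        abel
      | hs c => simp only [AlgHom.commutes]
      | ha x y hx hy => simp only [map_add, hx, hy]
      | hm x y hx hy => simp only [map_mul, hx, hy]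
      | hd x y hx hy => exact (isUnitalInfinitesimal K R).coassoc_dot x y hx hy)
    (by
      ext x
      induction x using U2.induction with
      | hι r => simp [comulAlgHom_ι, counitAlgHom_ι]
      | hs c => simp only [AlgHom.commutes]
      | ha x y hx hy => rw [map_add, hx, hy, map_add]
      | hm x y hx hy => rw [map_mul, hx, hy, map_mul]
      | hd x y hx hy =>
        exact (isUnitalInfinitesimal K R).rTensor_counit_dot (counitAlgHom_dot K R)
          x y hx hy)
    (by
      ext x
      induction x using U2.induction with
      | hι r => simp [comulAlgHom_ι, counitAlgHom_ι]
      | hs c => simp only [AlgHom.commutes]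
      | ha x y hx hy => rw [map_add, hx, hy, map_add]
      | hm x y hx hy => rw [map_mul, hx, hy, map_mul]
      | hd x y hx hy =>
        exact (isUnitalInfinitesimal K R).lTensor_counit_dot (counitAlgHom_dot K R)
          x y hx hy)

end Comul

end U2
end Enveloping

section TensorCoalgebra

/-- A 2-associative algebra regarded as an associative algebra for the product `·`. -/
def DotAlg (K A : Type*) [Field K] [Ring A] [Algebra K A] [TwoAssocAlgebra K A] := A

namespace DotAlg

variable (K A : Type*) [Field K] [Ring A] [Algebra K A] [TwoAssocAlgebra K A]

instance : AddCommGroup (DotAlg K A) := inferInstanceAs (AddCommGroup A)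

instance : Module K (DotAlg K A) := inferInstanceAs (Module K A)

instance : One (DotAlg K A) := inferInstanceAs (One A)

instance : Mul (DotAlg K A) := ⟨fun x y => (TwoAssocAlgebra.dot (K := K) (A := A) x y : A)⟩

/-- The identity map. -/
def of : A ≃ₗ[K] DotAlg K A := LinearEquiv.refl K A

instance : Ring (DotAlg K A) where
  __ := (inferInstance : AddCommGroup (DotAlg K A))
  mul_assoc x y z := TwoAssocAlgebra.dot_assoc (K := K) (A := A) x y z
  one_mul x := TwoAssocAlgebra.one_dot (K := K) (A := A) x
  mul_one x := TwoAssocAlgebra.dot_one (K := K) (A := A) x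
  left_distrib x y z := map_add (TwoAssocAlgebra.dot (K := K) (A := A) x) y z
  right_distrib x y z := LinearMap.map_add₂ (TwoAssocAlgebra.dot (K := K) (A := A)) x y z
  zero_mul x := LinearMap.map_zero₂ (TwoAssocAlgebra.dot (K := K) (A := A)) x
  mul_zero x := map_zero (TwoAssocAlgebra.dot (K := K) (A := A) x)

instance : Algebra K (DotAlg K A) :=
  Algebra.ofModule (fun c x y => LinearMap.map_smul₂ (TwoAssocAlgebra.dot (K := K) (A := A)) c x y)
    (fun c x y => map_smul (TwoAssocAlgebra.dot (K := K) (A := A) x) c y)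

end DotAlg

variable (K V : Type*) [Field K] [AddCommGroup V] [Module K V]

/-- The tensor coalgebra `T^c(V)`: the tensor module over `V` with the deconcatenation coproduct
(see `TensorCoalgebra.comul_word`). -/
def TensorCoalgebra := TensorAlgebra K V

namespace TensorCoalgebra

instance : AddCommGroup (TensorCoalgebra K V) := inferInstanceAs (AddCommGroup (TensorAlgebra K V))

instance : Module K (TensorCoalgebra K V) := inferInstanceAs (Module K (TensorAlgebra K V))

/-- `x ↦ (x, Δ x)`, multiplicative for the concatenation product on the source and the product `·`
of `UIExt` on the target, so that `Δ (x y) = (x ⊗ 1) Δ y + Δ x (1 ⊗ y) - x ⊗ y`. -/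
noncomputable def comulAux :
    TensorAlgebra K V →ₐ[K] DotAlg K (UIExt K (TensorAlgebra K V)) :=
  TensorAlgebra.lift K ((DotAlg.of K _).toLinearMap ∘ₗ primExt K (TensorAlgebra K V) ∘ₗ
    TensorAlgebra.ι K)

/-- The deconcatenation coproduct, on the tensor algebra. -/
noncomputable def deconcat : TensorAlgebra K V →ₗ[K] TensorAlgebra K V ⊗[K] TensorAlgebra K V :=
  LinearMap.snd K _ _ ∘ₗ (DotAlg.of K (UIExt K (TensorAlgebra K V))).symm.toLinearMap ∘ₗ
    (comulAux K V).toLinearMap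

theorem comulAux_fst (x : TensorAlgebra K V) :
    ((DotAlg.of K (UIExt K (TensorAlgebra K V))).symm (comulAux K V x)).1 = x := by
  induction x using TensorAlgebra.induction with
  | algebraMap c =>
    rw [AlgHom.commutes, Algebra.algebraMap_eq_smul_one, map_smul, Prod.smul_fst,
      Algebra.algebraMap_eq_smul_one]
    rfl
  | ι v => rw [comulAux, TensorAlgebra.lift_ι_apply]; rfl
  | mul x y hx hy =>
    rw [map_mul]
    exact (congrArg₂ (· * ·) hx hy : _)
  | add x y hx hy => rw [map_add, map_add, Prod.fst_add, hx, hy]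

theorem deconcat_one : deconcat K V 1 = 1 ⊗ₜ 1 := by
  change ((DotAlg.of K (UIExt K (TensorAlgebra K V))).symm (comulAux K V 1)).2 = _
  rw [map_one]
  rfl

theorem deconcat_ι (v : V) : deconcat K V (TensorAlgebra.ι K v) =
    TensorAlgebra.ι K v ⊗ₜ 1 + 1 ⊗ₜ TensorAlgebra.ι K v := by
  change ((DotAlg.of K (UIExt K (TensorAlgebra K V))).symm (comulAux K V _)).2 = _
  rw [comulAux, TensorAlgebra.lift_ι_apply]
  rfl

theorem isUnitalInfinitesimal : IsUnitalInfinitesimal K (deconcat K V) := by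
  intro x y
  change ((DotAlg.of K (UIExt K (TensorAlgebra K V))).symm (comulAux K V (x * y))).2 = _
  rw [map_mul]
  refine (UIExt.dot_snd K (TensorAlgebra K V)
    ((DotAlg.of K (UIExt K (TensorAlgebra K V))).symm (comulAux K V x))
    ((DotAlg.of K (UIExt K (TensorAlgebra K V))).symm (comulAux K V y))).trans ?_
  rw [comulAux_fst, comulAux_fst]
  rfl

/-- The counit of the tensor coalgebra: the projection onto `V^{⊗0} = K`. -/
noncomputable def counitAux : TensorAlgebra K V →ₗ[K] K :=
  (TensorAlgebra.algebraMapInv (R := K) (M := V)).toLinearMap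

theorem counitAux_ι (v : V) : counitAux K V (TensorAlgebra.ι K v) = 0 := by
  simp [counitAux, TensorAlgebra.algebraMapInv]

theorem counitAux_one : counitAux K V 1 = 1 := by simp [counitAux]

theorem counitAux_dot (x y : TensorAlgebra K V) :
    counitAux K V (TwoAssocAlgebra.dot (K := K) x y) = counitAux K V x * counitAux K V y :=
  map_mul (TensorAlgebra.algebraMapInv (R := K) (M := V)) x y

variable {K V} in
theorem linearMap_ext_aux {X : Type*} [AddCommGroup X] [Module K X]
    (f g : TensorAlgebra K V →ₗ[K] X) (h1 : f 1 = g 1)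
    (hι : ∀ v, f (TensorAlgebra.ι K v) = g (TensorAlgebra.ι K v))
    (hm : ∀ x y, f x = g x → f y = g y → f (x * y) = g (x * y)) : f = g := by
  ext x
  induction x using TensorAlgebra.induction with
  | algebraMap c => rw [Algebra.algebraMap_eq_smul_one, map_smul, map_smul, h1]
  | ι v => exact hι v
  | mul x y hx hy => exact hm x y hx hy
  | add x y hx hy => rw [map_add, map_add, hx, hy]

theorem coassoc_aux : (TensorProduct.assoc K _ _ _).toLinearMap ∘ₗ
    (deconcat K V).rTensor _ ∘ₗ deconcat K V = (deconcat K V).lTensor _ ∘ₗ deconcat K V :=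
  linearMap_ext_aux _ _
    (by simp [deconcat_one])
    (fun v => by
      simp [deconcat_ι, deconcat_one, TensorProduct.add_tmul, TensorProduct.tmul_add]
      abel)
    (fun x y hx hy => (isUnitalInfinitesimal K V).coassoc_dot x y hx hy)

theorem rTensor_counit_aux : (counitAux K V).rTensor _ ∘ₗ deconcat K V =
    TensorProduct.mk K K (TensorAlgebra K V) 1 :=
  linearMap_ext_aux _ _
    (by simp [deconcat_one, counitAux_one])
    (fun v => by simp [deconcat_ι, counitAux_one, counitAux_ι])
    (fun x y hx hy => (isUnitalInfinitesimal K V).rTensor_counit_dot (counitAux_dot K V) x y hx hy)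

theorem lTensor_counit_aux : (counitAux K V).lTensor _ ∘ₗ deconcat K V =
    (TensorProduct.mk K (TensorAlgebra K V) K).flip 1 :=
  linearMap_ext_aux _ _
    (by simp [deconcat_one, counitAux_one])
    (fun v => by simp [deconcat_ι, counitAux_one, counitAux_ι])
    (fun x y hx hy => (isUnitalInfinitesimal K V).lTensor_counit_dot (counitAux_dot K V) x y hx hy)

noncomputable instance : Coalgebra K (TensorCoalgebra K V) where
  comul := deconcat K V
  counit := counitAux K V
  coassoc := coassoc_aux K V
  rTensor_counit_comp_comul := rTensor_counit_aux K V
  lTensor_counit_comp_comul := lTensor_counit_aux K V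

/-- The element `v₁ ⋯ v_n` of `V^{⊗n} ⊆ T^c(V)`. -/
noncomputable def word (w : List V) : TensorCoalgebra K V :=
  (w.map (TensorAlgebra.ι K)).prod

/-- `Δ (v₁ ⋯ v_n) = ∑_{i=0}^n v₁ ⋯ v_i ⊗ v_{i+1} ⋯ v_n`. -/
theorem comul_word (w : List V) : Coalgebra.comul (R := K) (word K V w) =
    ∑ i ∈ Finset.range (w.length + 1), word K V (w.take i) ⊗ₜ[K] word K V (w.drop i) := by
  change deconcat K V (w.map (TensorAlgebra.ι K)).prod =
    ∑ i ∈ Finset.range (w.length + 1), ((w.take i).map (TensorAlgebra.ι K)).prod ⊗ₜ[K]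
      ((w.drop i).map (TensorAlgebra.ι K)).prod
  induction w with
  | nil => simp [deconcat_one]
  | cons v w ih =>
    have hd : ∀ a b : TensorAlgebra K V, TwoAssocAlgebra.dot (K := K) a b = a * b :=
      fun _ _ => rfl
    rw [List.map_cons, List.prod_cons, ← hd, isUnitalInfinitesimal K V, ih, List.length_cons,
      Finset.sum_range_succ' _ (w.length + 1), deconcat_ι]
    simp [hd]
    abel

end TensorCoalgebra
end TensorCoalgebra

section Category

open CategoryTheory

/-- The primitive part of a bialgebra. -/
def primitivePart (K H : Type*) [Field K] [Ring H] [Bialgebra K H] : Submodule K H where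
  carrier := {x | Coalgebra.comul (R := K) x = x ⊗ₜ 1 + 1 ⊗ₜ x}
  add_mem' {x y} hx hy := by
    simp only [Set.mem_ofPred_eq] at *
    rw [map_add, hx, hy, TensorProduct.add_tmul, TensorProduct.tmul_add]
    abel
  zero_mem' := by simp
  smul_mem' c x hx := by
    simp only [Set.mem_ofPred_eq] at *
    rw [map_smul, hx, smul_add, TensorProduct.smul_tmul', TensorProduct.tmul_smul]

/-- A bialgebra `H` is cofree if, as a coalgebra, it is isomorphic to `T^c(Prim H)`. -/
def IsCofree (K : Type u) [Field K] : ObjectProperty (BialgCat.{v} K) := fun H =>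
  Nonempty (H ≃ₗc[K] TensorCoalgebra K (primitivePart K H))

/-- A bialgebra is of the form `U2(R)` if it is isomorphic, as a bialgebra, to the universal
enveloping algebra `U2(R)` of some `B_∞`-algebra `R`. -/
def IsU2 (K : Type u) [Field K] : ObjectProperty (BialgCat.{v} K) := fun H =>
  ∃ (R : Type v) (_ : AddCommGroup R) (_ : Module K R) (_ : BInfinityAlgebra K R),
    Nonempty (H ≃ₐc[K] U2 K R)

/-- The category of cofree bialgebras, a full subcategory of the category of bialgebras. -/
abbrev CofreeBialgebras (K : Type u) [Field K] := (IsCofree.{u, v} K).FullSubcategory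

/-- The category of bialgebras of the form `U2(R)`, a full subcategory of the category of
bialgebras. -/
abbrev U2Bialgebras (K : Type u) [Field K] := (IsU2.{u, v} K).FullSubcategory

end Category
end CofreeHopf

/-! A bialgebra is cofree if and only if it is isomorphic to some `U2(R)`. The two full
subcategories are therefore cut out by the same property, and the equivalence is the identity.

The bridge is a formula for the product `*` of two `·`-words. If `op` computes the operations
`M_{pq}`, then `u * v` is the sum, over all ways of cutting `u` and `v` into blocks, of the
`·`-words with letters `op u₁ v₁, …, op u_k v_k` (`dotProd_mul_dotProd`). Expand `(u * v) * w` and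
`u * (v * w)` in this way and sort the terms by their first letter. Both satisfy a recursion of the
same shape over triples of cuts, and the first letters that occur are the two sides of the `B_∞`
relation. By induction on total length, the relations imply associativity
(`leftTriple_eq_rightTriple`), and associativity implies the relations when the letters embed
injectively (`fullSum_eq_of_leftTriple_eq`).

From `U2(R)` to cofree: the `·`-morphism from the tensor algebra on `R` to `U2(R)` extending `ι` is
a coalgebra map, because `R` is primitive and the infinitesimal relation determines `Δ` on
`·`-products. It is surjective since the formula above makes its image stable under `*`. It is
injective because the formula, read as a definition, makes the tensor module a 2-associative algebra
`StarAlg` with the prescribed operations; the universal property then gives a left inverse. So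
`U2(R)` is `T^c(R)` as a coalgebra, and `R` is identified with the primitive part.

From cofree to `U2(V)`: transport concatenation along a coalgebra isomorphism `H ≃ T^c(V)`. This
isomorphism preserves `1`, as `1` is the only group-like element of `T^c(V)`. Thus `H` is
2-associative and satisfies the infinitesimal relation, its primitive elements are a copy of `V`,
and they are stable under `M_{pq}`. Associativity of `*` makes `V` a `B_∞`-algebra. The induced map
`U2(V) → H` is bijective because, precomposed with the surjection from the tensor algebra onto
`U2(V)`, it becomes the inverse of the given isomorphism. -/

namespace CofreeHopf

/-! ### Sums over all cuttings of two words, with any number of blocks -/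

section FullSum

variable {R S X : Type*} [AddCommMonoid X]

/-- The sum of `F [m u₁ v₁, …, m u_k v_k]` over all `k` and all ways of cutting `u` and `v` into
`k` blocks. -/
def fullSum (m : List R → List R → S) (u v : List R) (F : List S → X) : X :=
  ∑ k ∈ Finset.range (u.length + v.length + 1), blockSum m k u v F

theorem fullSum_eq (m : List R → List R → S) (u v : List R) (F : List S → X) (N : ℕ)
    (hN : u.length + v.length ≤ N) :
    ∑ k ∈ Finset.range (N + 1), blockSum m k u v F = fullSum m u v F := by
  refine (Finset.sum_subset ?_ ?_).symm
  · intro k; simp only [Finset.mem_range]; omega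
  · intro k _ hk
    refine blockSum_of_lt _ _ _ _ _ ?_
    simp only [Finset.mem_range] at hk; omega

@[simp] theorem fullSum_nil (m : List R → List R → S) (F : List S → X) :
    fullSum m [] [] F = F [] := by
  simp [fullSum, blockSum]

/-- Classify the cuttings by their first block; a pair of words that are not both empty has no
cutting into zero blocks. -/
theorem fullSum_rec (m : List R → List R → S) (u v : List R) (F : List S → X)
    (h : ¬(u.length = 0 ∧ v.length = 0)) :
    fullSum m u v F =
      cutSum u v (fun a b c d => fullSum m c d (fun w => F (m a b :: w))) := by
  -- A vanishing extra term with `|u| + |v| + 1` blocks is added, so that once the term `k = 0` is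
  -- split off the range still has the form `N + 1` required by `fullSum_eq`.
  rw [← fullSum_eq m u v F (u.length + v.length + 1) (by omega), Finset.sum_range_succ']
  rw [blockSum, if_neg h, add_zero]
  simp only [cutSum, blockSum]
  rw [Finset.sum_comm]
  refine Finset.sum_congr rfl fun i hi => ?_
  rw [Finset.sum_comm]
  refine Finset.sum_congr rfl fun j hj => ?_
  split_ifs with h0
  · simp
  · rw [fullSum_eq]
    simp only [List.length_drop]; omega

theorem map_fullSum {Y : Type*} [AddCommMonoid Y] (g : X →+ Y) (m : List R → List R → S)
    (u v : List R) (F : List S → X) :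
    fullSum m u v (fun w => g (F w)) = g (fullSum m u v F) := by
  simp only [fullSum, map_sum, map_blockSum]

theorem blockSum_add (m : List R → List R → S) (k : ℕ) (u v : List R) (F G : List S → X) :
    blockSum m k u v (fun w => F w + G w) = blockSum m k u v F + blockSum m k u v G := by
  induction k generalizing u v F G with
  | zero => simp only [blockSum]; split_ifs <;> simp
  | succ k ih =>
    simp only [blockSum, ← Finset.sum_add_distrib]
    refine Finset.sum_congr rfl fun i _ => Finset.sum_congr rfl fun j _ => ?_
    split_ifs
    · simp
    · exact ih _ _ _ _

theorem blockSum_zero (m : List R → List R → S) (k : ℕ) (u v : List R) :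
    blockSum m k u v (fun _ => (0 : X)) = 0 := by
  induction k generalizing u v with
  | zero => simp [blockSum]
  | succ k ih => simp [blockSum, ih]

theorem fullSum_add (m : List R → List R → S) (u v : List R) (F G : List S → X) :
    fullSum m u v (fun w => F w + G w) = fullSum m u v F + fullSum m u v G := by
  simp only [fullSum, blockSum_add, Finset.sum_add_distrib]

theorem fullSum_zero (m : List R → List R → S) (u v : List R) :
    fullSum m u v (fun _ => (0 : X)) = 0 := by
  simp only [fullSum, blockSum_zero, Finset.sum_const_zero]

theorem fullSum_sum {ι : Type*} (s : Finset ι) (m : List R → List R → S) (u v : List R)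
    (F : ι → List S → X) :
    fullSum m u v (fun w => ∑ i ∈ s, F i w) = ∑ i ∈ s, fullSum m u v (F i) := by
  classical
  induction s using Finset.induction_on with
  | empty => simp [fullSum_zero]
  | insert a s ha ih => simp only [Finset.sum_insert ha, fullSum_add, ih]

theorem blockSum_congr_length (m : List R → List R → S) (k : ℕ) (u v : List R)
    (F G : List S → X) (h : ∀ w, w.length = k → F w = G w) :
    blockSum m k u v F = blockSum m k u v G := by
  induction k generalizing u v F G with
  | zero => simp only [blockSum, h [] rfl]
  | succ k ih =>
    simp only [blockSum]
    refine Finset.sum_congr rfl fun i _ => Finset.sum_congr rfl fun j _ => ?_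
    split_ifs
    · rfl
    · exact ih _ _ _ _ fun w hw => h _ (by simp [hw])

theorem blockSum_map {T : Type*} (f : S → T) (m : List R → List R → S) (k : ℕ) (u v : List R)
    (F : List T → X) :
    blockSum m k u v (fun w => F (w.map f)) = blockSum (fun a b => f (m a b)) k u v F := by
  induction k generalizing u v F with
  | zero => simp [blockSum]
  | succ k ih =>
    simp only [blockSum]
    refine Finset.sum_congr rfl fun i _ => Finset.sum_congr rfl fun j _ => ?_
    split_ifs
    · rfl
    · exact ih _ _ (fun w => F (f (m (u.take i) (v.take j)) :: w))

theorem blockSum_swap (m : List R → List R → S) (k : ℕ) (u v : List R) (F : List S → X) :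
    blockSum m k u v F = blockSum (fun a b => m b a) k v u F := by
  induction k generalizing u v F with
  | zero => simp only [blockSum, and_comm]
  | succ k ih =>
    simp only [blockSum]
    rw [Finset.sum_comm]
    refine Finset.sum_congr rfl fun i _ => Finset.sum_congr rfl fun j _ => ?_
    simp only [and_comm (a := i = 0)]
    split_ifs
    · rfl
    · exact ih _ _ _

/-- Cutting a sequence of blocks amounts to cutting the two words. -/
theorem fullSum_split (m : List R → List R → S) (u v : List R) (G : List S → List S → X) :
    fullSum m u v (fun x => ∑ i ∈ Finset.range (x.length + 1), G (x.take i) (x.drop i)) =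
      ∑ i ∈ Finset.range (u.length + 1), ∑ j ∈ Finset.range (v.length + 1),
        fullSum m (u.take i) (v.take j) (fun x => fullSum m (u.drop i) (v.drop j) (G x)) := by
  induction hN : u.length + v.length using Nat.strong_induction_on generalizing u v G with
  | _ N ih =>
    by_cases huv : u.length = 0 ∧ v.length = 0
    · obtain rfl := List.length_eq_zero_iff.mp huv.1
      obtain rfl := List.length_eq_zero_iff.mp huv.2
      simp
    rw [fullSum_rec _ _ _ _ huv]
    -- A cut of the block sequence lies either after the first block, where the induction hypothesis
    -- applies to the remaining words, or before it, which gives the summand with `G []`.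
    have h1 : cutSum u v (fun a b c d => fullSum m c d (fun w =>
        ∑ i ∈ Finset.range ((m a b :: w).length + 1),
          G ((m a b :: w).take i) ((m a b :: w).drop i))) =
        (∑ i ∈ Finset.range (u.length + 1), ∑ j ∈ Finset.range (v.length + 1),
          ∑ k ∈ Finset.range (u.length - i + 1), ∑ l ∈ Finset.range (v.length - j + 1),
            if i = 0 ∧ j = 0 then 0 else
              fullSum m ((u.drop i).take k) ((v.drop j).take l) (fun x =>
                fullSum m (u.drop (i + k)) (v.drop (j + l))
                  (G (m (u.take i) (v.take j) :: x)))) + fullSum m u v (G []) := by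
      rw [fullSum_rec m u v (G []) huv]
      simp only [cutSum, ← Finset.sum_add_distrib]
      refine Finset.sum_congr rfl fun i hi => Finset.sum_congr rfl fun j hj => ?_
      simp only [Finset.mem_range] at hi hj
      split_ifs with h0
      · simp
      · simp only [List.length_cons, Finset.sum_range_succ' _ (_ + 1), List.take_succ_cons,
          List.drop_succ_cons, List.take_zero, List.drop_zero, fullSum_add]
        rw [ih _ _ (u.drop i) (v.drop j) (fun x y => G (m (u.take i) (v.take j) :: x) y) rfl]
        · simp only [List.length_drop, List.drop_drop]
        · simp only [List.length_drop]; omega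
    -- Reindex by the end points `s = i + k` and `t = j + l` of the initial segments. For fixed `(s,
    -- t)` the inner sum is then the first-block recursion for `u.take s` and `v.take t`.
    rw [h1, sum_flip u.length v.length (fun i j k l => if i = 0 ∧ j = 0 then 0 else
              fullSum m ((u.drop i).take k) ((v.drop j).take l) (fun x =>
                fullSum m (u.drop (i + k)) (v.drop (j + l))
                  (G (m (u.take i) (v.take j) :: x))))]
    -- The cuts before the first block supply the term `s = t = 0`, which the recursion misses
    -- because it needs a nonempty first block.
    have h2 : fullSum m u v (G []) = ∑ s ∈ Finset.range (u.length + 1),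
        ∑ t ∈ Finset.range (v.length + 1), if s = 0 ∧ t = 0 then
          fullSum m (u.take s) (v.take t) (fun x => fullSum m (u.drop s) (v.drop t) (G x))
          else 0 := by
      rw [Finset.sum_eq_single 0, Finset.sum_eq_single 0]
      · simp
      · intro t _ ht; simp [ht]
      · simp
      · intro s _ hs; simp [hs]
      · simp
    rw [h2]
    simp only [← Finset.sum_add_distrib]
    refine Finset.sum_congr rfl fun s hs => Finset.sum_congr rfl fun t ht => ?_
    simp only [Finset.mem_range] at hs ht
    by_cases hst : s = 0 ∧ t = 0
    · obtain ⟨rfl, rfl⟩ := hst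
      simp
    · have hus : (u.take s).length = s := by simp only [List.length_take]; omega
      have hvt : (v.take t).length = t := by simp only [List.length_take]; omega
      rw [if_neg hst, add_zero, fullSum_rec m (u.take s) (v.take t) _ (by rwa [hus, hvt])]
      simp only [cutSum, hus, hvt]
      refine Finset.sum_congr rfl fun i hi => Finset.sum_congr rfl fun j hj => ?_
      simp only [Finset.mem_range] at hi hj
      split_ifs with h0
      · rfl
      · rw [List.take_take, List.take_take, List.drop_take, List.drop_take,
            min_eq_left (by omega), min_eq_left (by omega),
            show i + (s - i) = s by omega, show j + (t - j) = t by omega]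

end FullSum

/-! ### Associativity of `*` and the `B_∞` relations -/

section TripleCut

variable {K R A : Type*} [Field K] [AddCommGroup R] [Module K R] [Ring A] [Algebra K A]
  [TwoAssocAlgebra K A]

theorem totalSum_eq_fullSum {R : Type*} (f : R → A) (op : List R → List R → R) (u v : List R) :
    totalSum K (fun a b => f (op a b)) u v =
      fullSum op u v (fun x => dotProd K (x.map f)) := by
  simp only [totalSum, fullSum, blockSum_map f op _ _ _ (dotProd K)]

/-- When `m [] [] = 0`, an empty first block contributes nothing, so the side condition of
`totalSum_rec` can be traded for a unit term. Being unconditional, this form can be rewritten inside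
a sum over words `x` of varying length. -/
theorem totalSum_eq_add {R : Type*} (m : List R → List R → A) (h0 : m [] [] = 0) (u v : List R) :
    totalSum K m u v = (if u.length = 0 ∧ v.length = 0 then 1 else 0) +
      ∑ i ∈ Finset.range (u.length + 1), ∑ j ∈ Finset.range (v.length + 1),
        TwoAssocAlgebra.dot (K := K) (m (u.take i) (v.take j))
          (totalSum K m (u.drop i) (v.drop j)) := by
  by_cases huv : u.length = 0 ∧ v.length = 0
  · obtain rfl := List.length_eq_zero_iff.mp huv.1
    obtain rfl := List.length_eq_zero_iff.mp huv.2
    simp [h0, totalSum_nil]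
  · rw [if_neg huv, zero_add, totalSum_rec K m u v huv]
    refine Finset.sum_congr rfl fun i _ => Finset.sum_congr rfl fun j _ => ?_
    split_ifs with h
    · simp [h.1, h.2, h0]
    · rfl

theorem fullSum_ite_nil {R A : Type*} [Ring A] (op : List R → List R → R) (u v : List R)
    (h : ¬(u.length = 0 ∧ v.length = 0)) (c : Prop) [Decidable c] :
    fullSum op u v (fun x => if x.length = 0 ∧ c then (1 : A) else 0) = 0 := by
  rw [fullSum_rec _ _ _ _ h]
  simp [cutSum, fullSum_zero]

/-- `(u * v) * w`, expanded over blocks. -/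
def leftTriple (K : Type*) {R A : Type*} [Field K] [AddCommGroup R] [Module K R] [Ring A]
    [Algebra K A] [TwoAssocAlgebra K A] (f : R →ₗ[K] A) (op : List R → List R → R)
    (u v w : List R) : A :=
  fullSum op u v (fun x => totalSum K (fun a b => f (op a b)) x w)

/-- `u * (v * w)`, expanded over blocks. -/
def rightTriple (K : Type*) {R A : Type*} [Field K] [AddCommGroup R] [Module K R] [Ring A]
    [Algebra K A] [TwoAssocAlgebra K A] (f : R →ₗ[K] A) (op : List R → List R → R)
    (u v w : List R) : A :=
  fullSum op v w (fun x => totalSum K (fun a b => f (op a b)) u x)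

/-- The sum over all triples of cuts. -/
def tripleCut {R X : Type*} [AddCommMonoid X] (u v w : List R)
    (g : List R → List R → List R → List R → List R → List R → X) : X :=
  ∑ i ∈ Finset.range (u.length + 1), ∑ j ∈ Finset.range (v.length + 1),
    ∑ k ∈ Finset.range (w.length + 1),
      g (u.take i) (v.take j) (w.take k) (u.drop i) (v.drop j) (w.drop k)

variable (f : R →ₗ[K] A) (op : List R → List R → R)

theorem fullSum_fullSum_dot {op} (u v u' v' : List R) (F : List R → R) (G : List R → A) :
    fullSum op u v (fun x => fullSum op u' v' (fun y =>
      TwoAssocAlgebra.dot (K := K) (f (F x)) (G y))) =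
    TwoAssocAlgebra.dot (K := K) (f (fullSum op u v F)) (fullSum op u' v' G) := by
  have h1 : ∀ a : A, fullSum op u' v' (fun y => TwoAssocAlgebra.dot (K := K) a (G y)) =
      TwoAssocAlgebra.dot (K := K) a (fullSum op u' v' G) := fun a =>
    map_fullSum (TwoAssocAlgebra.dot (K := K) a).toAddMonoidHom op u' v' G
  simp only [h1]
  exact map_fullSum ((TwoAssocAlgebra.dot (K := K) (A := A)).flip
    (fullSum op u' v' G) ∘ₗ f).toAddMonoidHom op u v F

/-- Sort the terms of the outer product by their first letter `op x c`, where `c` is a prefix of `w`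
and `x` is a prefix of the block sequence of `u` and `v`. By `fullSum_split`, such prefixes come
from cutting `u` and `v`. Summing over `x` turns the first letter into the left side of the `B_∞`
relation for the three prefixes, and leaves the same triple product for the three remainders. -/
theorem leftTriple_eq_tripleCut (h0 : op [] [] = 0) (u v w : List R)
    (h : ¬(u.length = 0 ∧ v.length = 0 ∧ w.length = 0)) :
    leftTriple K f op u v w = tripleCut u v w (fun a b c a' b' c' =>
      TwoAssocAlgebra.dot (K := K) (f (fullSum op a b (fun x => op x c)))
        (leftTriple K f op a' b' c')) := by
  rw [leftTriple]
  simp only [totalSum_eq_add (K := K) (fun a b => f (op a b)) (by simp [h0]) _ w]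
  rw [fullSum_add]
  -- The unit term needs an empty block sequence and an empty `w`; when `w` is empty the pair `u`,
  -- `v` is not, so it is cut into at least one block.
  have hz : fullSum op u v (fun x => if x.length = 0 ∧ w.length = 0 then (1 : A) else 0) = 0 := by
    by_cases hw : w.length = 0
    · exact fullSum_ite_nil op u v (by tauto) _
    · simp [hw, fullSum_zero]
  rw [hz, zero_add, fullSum_split op u v (fun x y => ∑ k ∈ Finset.range (w.length + 1),
    TwoAssocAlgebra.dot (K := K) (f (op x (w.take k)))
      (totalSum K (fun a b => f (op a b)) y (w.drop k)))]
  refine Finset.sum_congr rfl fun i _ => Finset.sum_congr rfl fun j _ => ?_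
  simp only [fullSum_sum]
  refine Finset.sum_congr rfl fun k _ => ?_
  exact fullSum_fullSum_dot f _ _ _ _ (fun x => op x (w.take k)) _

theorem rightTriple_eq_tripleCut (h0 : op [] [] = 0) (u v w : List R)
    (h : ¬(u.length = 0 ∧ v.length = 0 ∧ w.length = 0)) :
    rightTriple K f op u v w = tripleCut u v w (fun a b c a' b' c' =>
      TwoAssocAlgebra.dot (K := K) (f (fullSum op b c (fun x => op a x)))
        (rightTriple K f op a' b' c')) := by
  rw [rightTriple]
  simp only [totalSum_eq_add (K := K) (fun a b => f (op a b)) (by simp [h0]) u]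
  rw [fullSum_add]
  have hz : fullSum op v w (fun x => if u.length = 0 ∧ x.length = 0 then (1 : A) else 0) = 0 := by
    by_cases hu : u.length = 0
    · simp only [and_comm (a := u.length = 0)]
      exact fullSum_ite_nil op v w (by tauto) _
    · simp [hu, fullSum_zero]
  rw [hz, zero_add]
  simp only [fullSum_sum]
  refine Finset.sum_congr rfl fun i _ => ?_
  rw [fullSum_split op v w (fun x y => TwoAssocAlgebra.dot (K := K) (f (op (u.take i) x))
      (totalSum K (fun a b => f (op a b)) (u.drop i) y))]
  refine Finset.sum_congr rfl fun j _ => Finset.sum_congr rfl fun k _ => ?_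
  exact fullSum_fullSum_dot f _ _ _ _ (fun x => op (u.take i) x) _

theorem leftTriple_nil : leftTriple K f op [] [] [] = 1 := by simp [leftTriple, totalSum_nil]

theorem rightTriple_nil : rightTriple K f op [] [] [] = 1 := by simp [rightTriple, totalSum_nil]

/-- The relations of a `B_∞`-algebra imply associativity. -/
theorem leftTriple_eq_rightTriple (h0 : op [] [] = 0)
    (h : ∀ u v w : List R, fullSum op u v (fun x => op x w) = fullSum op v w (fun x => op u x))
    (u v w : List R) : leftTriple K f op u v w = rightTriple K f op u v w := by
  induction hN : u.length + v.length + w.length using Nat.strong_induction_on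
    generalizing u v w with
  | _ N ih =>
    by_cases huvw : u.length = 0 ∧ v.length = 0 ∧ w.length = 0
    · rw [List.length_eq_zero_iff.mp huvw.1, List.length_eq_zero_iff.mp huvw.2.1,
        List.length_eq_zero_iff.mp huvw.2.2, leftTriple_nil, rightTriple_nil]
    · rw [leftTriple_eq_tripleCut f op h0 u v w huvw, rightTriple_eq_tripleCut f op h0 u v w huvw]
      refine Finset.sum_congr rfl fun i hi => Finset.sum_congr rfl fun j hj =>
        Finset.sum_congr rfl fun k hk => ?_
      simp only [Finset.mem_range] at hi hj hk
      beta_reduce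
      rw [h]
      -- The cut with three empty prefixes is the only one that leaves the words unshortened, and
      -- its first factor is `op [] [] = 0`.
      by_cases h1 : i = 0 ∧ j = 0 ∧ k = 0
      · simp [h1.1, h1.2.1, h1.2.2, h0]
      · rw [ih _ _ (u.drop i) (v.drop j) (w.drop k) rfl]
        simp only [List.length_drop]; omega

/-- Associativity implies the relations of a `B_∞`-algebra. -/
theorem fullSum_eq_of_leftTriple_eq (h0 : op [] [] = 0) (hf : Function.Injective f)
    (h : ∀ u v w : List R, leftTriple K f op u v w = rightTriple K f op u v w)
    (u v w : List R) : fullSum op u v (fun x => op x w) = fullSum op v w (fun x => op u x) := by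
  induction hN : u.length + v.length + w.length using Nat.strong_induction_on
    generalizing u v w with
  | _ N ih =>
    by_cases huvw : u.length = 0 ∧ v.length = 0 ∧ w.length = 0
    · rw [List.length_eq_zero_iff.mp huvw.1, List.length_eq_zero_iff.mp huvw.2.1,
        List.length_eq_zero_iff.mp huvw.2.2, fullSum_nil, fullSum_nil]
    · have key := h u v w
      rw [leftTriple_eq_tripleCut f op h0 u v w huvw, rightTriple_eq_tripleCut f op h0 u v w huvw,
        ← sub_eq_zero] at key
      -- The triple products of the remainders agree by `h`, so the two recursions can differ only
      -- in their first factors.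
      simp only [← h, tripleCut, ← Finset.sum_sub_distrib] at key
      have hz : ∀ i ∈ Finset.range (u.length + 1), ∀ j ∈ Finset.range (v.length + 1),
          ∀ k ∈ Finset.range (w.length + 1),
          ¬(i = u.length ∧ j = v.length ∧ k = w.length) →
          TwoAssocAlgebra.dot (K := K) (f (fullSum op (u.take i) (v.take j)
              (fun x => op x (w.take k)))) (leftTriple K f op (u.drop i) (v.drop j) (w.drop k)) -
            TwoAssocAlgebra.dot (K := K) (f (fullSum op (v.take j) (w.take k)
              (fun x => op (u.take i) x))) (leftTriple K f op (u.drop i) (v.drop j) (w.drop k))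
            = 0 := by
        intro i hi j hj k hk hne
        simp only [Finset.mem_range] at hi hj hk
        rw [ih _ _ (u.take i) (v.take j) (w.take k) rfl, sub_self]
        simp only [List.length_take]; omega
      -- By induction every cut with a proper prefix cancels. The cut taking the whole words has
      -- second factor `1` and isolates the relation for `u`, `v`, `w` under `f`.
      rw [Finset.sum_eq_single u.length, Finset.sum_eq_single v.length,
        Finset.sum_eq_single w.length] at key
      · simp only [List.take_length, List.drop_length, leftTriple_nil,
          TwoAssocAlgebra.dot_one] at key
        exact hf (sub_eq_zero.mp key)
      · exact fun k hk hne => hz _ (by simp) _ (by simp) _ hk (by tauto)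
      · simp
      · exact fun j hj hne => Finset.sum_eq_zero fun k hk => hz _ (by simp) _ hj _ hk (by tauto)
      · simp
      · exact fun i hi hne => Finset.sum_eq_zero fun j hj => Finset.sum_eq_zero fun k hk =>
          hz _ hi _ hj _ hk (by tauto)
      · simp

end TripleCut

/-! ### Letterwise linear functions on words -/

section WordLinear

variable (K : Type*) {R S X Y : Type*} [Field K] [AddCommGroup R] [Module K R]
  [AddCommGroup S] [Module K S] [AddCommGroup X] [Module K X] [AddCommGroup Y] [Module K Y]

/-- A function on words that is linear in each letter. -/
def WordLinear (g : List R → X) : Prop :=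
  ∀ a b, IsLinearMap K fun x => g (a ++ x :: b)

theorem isLinearMap_zero : IsLinearMap K fun _ : R => (0 : X) := (0 : R →ₗ[K] X).isLinear

theorem isLinearMap_sum {ι : Type*} (s : Finset ι) (g : ι → R → X)
    (h : ∀ i ∈ s, IsLinearMap K (g i)) : IsLinearMap K fun x => ∑ i ∈ s, g i x := by
  constructor
  · intro x y
    rw [← Finset.sum_add_distrib]
    exact Finset.sum_congr rfl fun i hi => (h i hi).map_add x y
  · intro c x
    rw [Finset.smul_sum]
    exact Finset.sum_congr rfl fun i hi => (h i hi).map_smul c x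

theorem isLinearMap_comp (l : X →ₗ[K] Y) (g : R → X) (h : IsLinearMap K g) :
    IsLinearMap K fun x => l (g x) :=
  (l ∘ₗ h.mk' g).isLinear

theorem isLinearMap_ite (c : Prop) [Decidable c] (g h : R → X) (hg : c → IsLinearMap K g)
    (hh : ¬c → IsLinearMap K h) : IsLinearMap K fun x => if c then g x else h x := by
  by_cases hc : c
  · simpa only [if_pos hc] using hg hc
  · simpa only [if_neg hc] using hh hc

variable {K}

theorem isLinearMap_blockSum {S T : Type*} (m : List T → List T → S) (k : ℕ) (u v : List T)
    (F : R → List S → X) (hF : ∀ w, IsLinearMap K fun x => F x w) :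
    IsLinearMap K fun x => blockSum m k u v (F x) := by
  induction k generalizing u v F with
  | zero => exact isLinearMap_ite K _ _ _ (fun _ => hF []) (fun _ => isLinearMap_zero K)
  | succ k ih =>
    refine isLinearMap_sum K _ _ fun i _ => isLinearMap_sum K _ _ fun j _ => ?_
    exact isLinearMap_ite K _ _ _ (fun _ => isLinearMap_zero K) (fun _ => ih _ _ _ fun w => hF _)

/-- In each cutting the variable letter lies in exactly one block. If the first block ends before
it, induct on the remaining blocks. If the first block contains it, the letter enters through `m`
and the linearity of `F` in its first letter. -/
theorem WordLinear.blockSum_left {m : List R → List R → S} (hm : ∀ v, WordLinear K fun u => m u v)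
    (k : ℕ) (v : List R) (F : List S → X) (hF : WordLinear K F) :
    WordLinear K fun u => blockSum m k u v F := by
  intro a
  induction k generalizing a v F with
  | zero => intro b; simpa [blockSum] using isLinearMap_zero K
  | succ k ih =>
    intro b
    simp only [blockSum, List.length_append, List.length_cons]
    refine isLinearMap_sum K _ _ fun i hi => isLinearMap_sum K _ _ fun j _ => ?_
    refine isLinearMap_ite K _ _ _ (fun _ => isLinearMap_zero K) (fun _ => ?_)
    by_cases hia : i ≤ a.length
    · simp only [List.take_append_of_le_length hia, List.drop_append_of_le_length hia]
      exact ih (v.drop j) _ (fun c d => hF (m (a.take i) (v.take j) :: c) d) (a.drop i) b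
    · obtain ⟨t, rfl⟩ : ∃ t, i = a.length + (t + 1) := ⟨i - a.length - 1, by omega⟩
      simp only [List.take_length_add_append, List.drop_length_add_append, List.take_succ_cons,
        List.drop_succ_cons]
      refine isLinearMap_blockSum m k _ _ _ fun w => ?_
      exact isLinearMap_comp K ((hF [] w).mk' _) _ (hm (v.take j) a (b.take t))

theorem WordLinear.blockSum_right {m : List R → List R → S}
    (hm : ∀ u, WordLinear K fun v => m u v)
    (k : ℕ) (u : List R) (F : List S → X) (hF : WordLinear K F) :
    WordLinear K fun v => blockSum m k u v F := by
  simp only [blockSum_swap m]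
  exact WordLinear.blockSum_left hm k u F hF

theorem WordLinear.comp {g : List R → X} (hg : WordLinear K g) (l : X →ₗ[K] Y) :
    WordLinear K fun u => l (g u) := fun a b => isLinearMap_comp K l _ (hg a b)

theorem WordLinear.map {g : List S → X} (hg : WordLinear K g) (l : R →ₗ[K] S) :
    WordLinear K fun u => g (u.map l) := by
  intro a b
  simp only [List.map_append, List.map_cons]
  exact ((hg (a.map l) (b.map l)).mk' _ ∘ₗ l).isLinear

theorem WordLinear.sum {ι : Type*} (s : Finset ι) (g : ι → List R → X)
    (h : ∀ i ∈ s, WordLinear K (g i)) : WordLinear K fun u => ∑ i ∈ s, g i u :=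
  fun a b => isLinearMap_sum K _ _ fun i hi => h i hi a b

/-- Varying one letter does not change the length of the word. A function whose definition involves
the length, such as a sum with a length-dependent range, may thus be replaced by a uniform one that
agrees with it in that length. -/
theorem WordLinear.of_length {g g' : List R → X} (n : ℕ) (hg : WordLinear K g)
    (h : ∀ u, u.length = n → g u = g' u) (a b : List R) (hn : a.length + (b.length + 1) = n) :
    IsLinearMap K fun x => g' (a ++ x :: b) := by
  have : (fun x => g' (a ++ x :: b)) = fun x => g (a ++ x :: b) := by
    funext x; exact (h _ (by simpa using hn)).symm
  rw [this]
  exact hg a b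

theorem WordLinear.fullSum_left {m : List R → List R → S} (hm : ∀ v, WordLinear K fun u => m u v)
    (v : List R) (F : List S → X) (hF : WordLinear K F) :
    WordLinear K fun u => fullSum m u v F := by
  intro a b
  refine WordLinear.of_length (a.length + (b.length + 1))
      (g' := fun u => fullSum m u v F) (g := fun u =>
    ∑ k ∈ Finset.range (a.length + (b.length + 1) + v.length + 1), blockSum m k u v F)
    (WordLinear.sum _ _ fun k _ => WordLinear.blockSum_left hm k v F hF) ?_ a b rfl
  intro u hu
  simp only [fullSum, hu]

theorem WordLinear.fullSum_right {m : List R → List R → S}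
    (hm : ∀ u, WordLinear K fun v => m u v)
    (u : List R) (F : List S → X) (hF : WordLinear K F) :
    WordLinear K fun v => fullSum m u v F := by
  intro a b
  refine WordLinear.of_length (a.length + (b.length + 1))
      (g' := fun v => fullSum m u v F) (g := fun v =>
    ∑ k ∈ Finset.range (u.length + (a.length + (b.length + 1)) + 1), blockSum m k u v F)
    (WordLinear.sum _ _ fun k _ => WordLinear.blockSum_right hm k u F hF) ?_ a b rfl
  intro v hv
  simp only [fullSum, hv]

section MPQ

variable {A : Type*} [Ring A] [Algebra K A] [TwoAssocAlgebra K A]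

theorem wordLinear_dotProd : WordLinear K (dotProd K : List A → A) := by
  intro a b
  induction a with
  | nil => exact (TwoAssocAlgebra.dot.flip (dotProd K b)).isLinear
  | cons y a ih => exact isLinearMap_comp K (TwoAssocAlgebra.dot y) _ ih

/-- `M_{pq}`, cut off at total arity `n`. -/
def mPQBelow (K : Type*) {A : Type*} [Field K] [Ring A] [Algebra K A] [TwoAssocAlgebra K A]
    (n : ℕ) (u v : List A) : A :=
  if u.length + v.length < n then mPQ K u v else 0

/-- Induction on the arity. The recursion for `mPQ` calls only smaller arities, whereas the
linearity of `blockSum` asks for operations that are linear on words of every length; truncation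
provides such operations. -/
theorem wordLinear_mPQBelow (n : ℕ) :
    (∀ v, WordLinear K fun u : List A => mPQBelow K n u v) ∧
      ∀ u, WordLinear K fun v : List A => mPQBelow K n u v := by
  induction n with
  | zero => constructor <;> intro v a b <;> simpa [mPQBelow] using isLinearMap_zero K
  | succ n ih =>
    -- In total arity `n` every term with at least two blocks involves only smaller arities, where
    -- `mPQBelow K n` and `mPQ` agree.
    have hrec : ∀ u v : List A, u.length + v.length = n → 0 < u.length → 0 < v.length →
        dotProd K u * dotProd K v - ∑ k ∈ Finset.Icc 2 n,
          blockSum (mPQBelow K n) k u v (dotProd K) = mPQ K u v := by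
      intro u v hn hu hv
      rw [mPQ_of_pos K u v hu hv, hn]
      congr 1
      refine Finset.sum_congr rfl fun k hk => ?_
      refine blockSum_congr_of_two_le _ _ k (Finset.mem_Icc.mp hk).1 u v (fun a b hab => ?_) _
      rw [mPQBelow, if_pos (by omega)]
    constructor
    · intro v a b
      by_cases hn : a.length + (b.length + 1) + v.length = n
      · have e : (fun x => mPQBelow K (n + 1) (a ++ x :: b) v) =
            fun x => mPQ K (a ++ x :: b) v := by
          funext x
          rw [mPQBelow, if_pos]
          simp only [List.length_append, List.length_cons]; omega
        rw [e]
        by_cases hv : v.length = 0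
        · obtain rfl := List.length_eq_zero_iff.mp hv
          by_cases hab : a = [] ∧ b = []
          · rw [hab.1, hab.2]
            simp only [List.nil_append, mPQ_one_zero]
            exact ⟨fun _ _ => rfl, fun _ _ => rfl⟩
          · have : ∀ x, mPQ K (a ++ x :: b) [] = 0 := by
              intro x
              apply mPQ_left_zero
              simp only [List.length_append, List.length_cons]
              rcases a with _ | _ <;> rcases b with _ | _ <;> simp at hab ⊢; omega
            simpa only [this] using isLinearMap_zero K
        · refine WordLinear.of_length (a.length + (b.length + 1))
              (g' := fun u => mPQ K u v) (g := fun u =>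
            dotProd K u * dotProd K v - ∑ k ∈ Finset.Icc 2 n,
              blockSum (mPQBelow K n) k u v (dotProd K)) ?_ ?_ a b rfl
          · intro c d
            exact ((wordLinear_dotProd.comp (LinearMap.mulRight K (dotProd K v)) c d).mk' _ -
              (WordLinear.sum (Finset.Icc 2 n) _ (fun k _ => WordLinear.blockSum_left ih.1 k v _
                wordLinear_dotProd) c d).mk' _).isLinear
          · intro u hu
            exact hrec u v (by omega) (by omega) (by omega)
      · have e : (fun x => mPQBelow K (n + 1) (a ++ x :: b) v) =
            fun x => mPQBelow K n (a ++ x :: b) v := by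
          funext x
          simp only [mPQBelow, List.length_append, List.length_cons]
          congr 1
          apply propext; omega
        rw [e]
        exact ih.1 v a b
    · intro u a b
      by_cases hn : u.length + (a.length + (b.length + 1)) = n
      · have e : (fun x => mPQBelow K (n + 1) u (a ++ x :: b)) =
            fun x => mPQ K u (a ++ x :: b) := by
          funext x
          rw [mPQBelow, if_pos]
          simp only [List.length_append, List.length_cons]; omega
        rw [e]
        by_cases hu : u.length = 0
        · obtain rfl := List.length_eq_zero_iff.mp hu
          by_cases hab : a = [] ∧ b = []
          · rw [hab.1, hab.2]
            simp only [List.nil_append, mPQ_zero_one]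
            exact ⟨fun _ _ => rfl, fun _ _ => rfl⟩
          · have : ∀ x, mPQ K [] (a ++ x :: b) = 0 := by
              intro x
              apply mPQ_zero_right
              simp only [List.length_append, List.length_cons]
              rcases a with _ | _ <;> rcases b with _ | _ <;> simp at hab ⊢; omega
            simpa only [this] using isLinearMap_zero K
        · refine WordLinear.of_length (a.length + (b.length + 1))
              (g' := fun v => mPQ K u v) (g := fun v =>
            dotProd K u * dotProd K v - ∑ k ∈ Finset.Icc 2 n,
              blockSum (mPQBelow K n) k u v (dotProd K)) ?_ ?_ a b rfl
          · intro c d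
            exact ((wordLinear_dotProd.comp (LinearMap.mulLeft K (dotProd K u)) c d).mk' _ -
              (WordLinear.sum (Finset.Icc 2 n) _ (fun k _ => WordLinear.blockSum_right ih.2 k u _
                wordLinear_dotProd) c d).mk' _).isLinear
          · intro v hv
            exact hrec u v (by omega) (by omega) (by omega)
      · have e : (fun x => mPQBelow K (n + 1) u (a ++ x :: b)) =
            fun x => mPQBelow K n u (a ++ x :: b) := by
          funext x
          simp only [mPQBelow, List.length_append, List.length_cons]
          congr 1
          apply propext; omega
        rw [e]
        exact ih.2 u a b

theorem wordLinear_mPQ_left (v : List A) : WordLinear K fun u : List A => mPQ K u v := by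
  intro a b
  refine WordLinear.of_length (a.length + (b.length + 1)) (g' := fun u => mPQ K u v)
    ((wordLinear_mPQBelow (a.length + (b.length + 1) + v.length + 1)).1 v) ?_ a b rfl
  intro u hu
  rw [mPQBelow, if_pos (by omega)]

theorem wordLinear_mPQ_right (u : List A) : WordLinear K fun v : List A => mPQ K u v := by
  intro a b
  refine WordLinear.of_length (a.length + (b.length + 1)) (g' := fun v => mPQ K u v)
    ((wordLinear_mPQBelow (u.length + (a.length + (b.length + 1)) + 1)).2 u) ?_ a b rfl
  intro u hu
  rw [mPQBelow, if_pos (by omega)]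

end MPQ

section Multilinear

theorem ofFn_update {T : Type*} {n : ℕ} [DecidableEq (Fin n)] (f : Fin n → T) (i : Fin n)
    (x : T) : List.ofFn (Function.update f i x) =
      (List.ofFn f).take i ++ x :: (List.ofFn f).drop (i + 1) := by
  have h : i.1 < (List.ofFn f).length := by simp
  rw [← List.set_eq_take_cons_drop x h]
  refine List.ext_getElem (by simp) fun j h1 h2 => ?_
  simp only [List.getElem_ofFn, List.getElem_set, Function.update_apply, Fin.ext_iff]
  simp only [eq_comm (a := i.1)]

/-- A function of words that is linear in each letter, as a family of multilinear maps. -/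
def WordLinear.toMultilinear {g : List R → X} (hg : WordLinear K g) (n : ℕ) :
    MultilinearMap K (fun _ : Fin n => R) X where
  toFun v := g (List.ofFn v)
  map_update_add' v i x y := by
    simp only [ofFn_update]
    exact (hg _ _).map_add x y
  map_update_smul' v i c x := by
    simp only [ofFn_update]
    exact (hg _ _).map_smul c x

theorem wordLinear_of_multilinear (M : (n : ℕ) → MultilinearMap K (fun _ : Fin n => R) X) :
    WordLinear K fun u => M u.length u.get := by
  have key : ∀ (n : ℕ) (u : List R) (h : u.length = n),
      M u.length u.get = M n fun i => u.get (i.cast h.symm) := by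
    rintro _ u rfl; rfl
  intro a b
  -- The arity of `M` depends on the word, so `key` moves it to an expression free of `x`. The
  -- letters then form an update at position `|a|` of the word having `0` there.
  have e : ∀ x, M (a ++ x :: b).length (a ++ x :: b).get =
      M (a.length + (b.length + 1)) (Function.update
        (fun i => (a ++ 0 :: b).get (i.cast (by simp))) ⟨a.length, by omega⟩ x) := by
    intro x
    rw [key (a.length + (b.length + 1)) _ (by simp)]
    congr 1
    funext i
    by_cases hi : i = ⟨a.length, by omega⟩
    · subst hi; simp
    · rw [Function.update_of_ne hi]
      have : i.1 ≠ a.length := fun h => hi (Fin.ext h)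
      simp only [List.get_eq_getElem, Fin.val_cast, List.getElem_append, List.getElem_cons]
      split_ifs <;> first | rfl | omega
  simp only [e]
  exact ((M _).toLinearMap _ _).isLinear

end Multilinear

/-! ### Linear maps on the tensor algebra given by their values on words -/

section LiftWords

variable (K) in
/-- The word `r₁ ⋯ r_n` in the tensor algebra. -/
def tword (u : List R) : TensorAlgebra K R := dotProd K (u.map (TensorAlgebra.ι K))

@[simp] theorem tword_nil : tword K ([] : List R) = 1 := rfl

@[simp] theorem tword_cons (r : R) (u : List R) :
    tword K (r :: u) = TensorAlgebra.ι K r * tword K u := rfl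

theorem tword_append (u v : List R) : tword K (u ++ v) = tword K u * tword K v := by
  induction u with
  | nil => simp
  | cons r u ih => simp [ih, mul_assoc]

theorem tword_singleton (r : R) : tword K [r] = TensorAlgebra.ι K r := by simp

theorem wordLinear_tword : WordLinear K (tword K : List R → TensorAlgebra K R) :=
  wordLinear_dotProd.map (TensorAlgebra.ι K)

theorem span_tword : Submodule.span K (Set.range (tword K : List R → TensorAlgebra K R)) = ⊤ := by
  rw [eq_top_iff]
  rintro x -
  induction x using TensorAlgebra.induction with
  | algebraMap c =>
    rw [Algebra.algebraMap_eq_smul_one]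
    exact Submodule.smul_mem _ _ (Submodule.subset_span ⟨[], rfl⟩)
  | ι r => exact Submodule.subset_span ⟨[r], tword_singleton r⟩
  | mul x y hx hy =>
    have h := Submodule.mul_mem_mul hx hy
    rw [Submodule.span_mul_span] at h
    refine Submodule.span_mono ?_ h
    rintro _ ⟨_, ⟨u, rfl⟩, _, ⟨v, rfl⟩, rfl⟩
    exact ⟨u ++ v, tword_append u v⟩
  | add x y hx hy => exact Submodule.add_mem _ hx hy

theorem tensorAlgebra_linear_ext {f g : TensorAlgebra K R →ₗ[K] X}
    (h : ∀ u, f (tword K u) = g (tword K u)) : f = g :=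
  LinearMap.ext_on span_tword (by rintro _ ⟨u, rfl⟩; exact h u)

/-- The linear map on the tensor algebra with given values on words. -/
noncomputable def WordLinear.lift {g : List R → X} (hg : WordLinear K g) :
    TensorAlgebra K R →ₗ[K] X :=
  DirectSum.toModule K ℕ X (fun n => PiTensorProduct.lift (hg.toMultilinear n)) ∘ₗ
    TensorAlgebra.equivDirectSum.toLinearMap

theorem WordLinear.lift_tword {g : List R → X} (hg : WordLinear K g) (u : List R) :
    hg.lift (tword K u) = g u := by
  have h : tword K u = TensorAlgebra.tprod K R u.length u.get := by
    rw [TensorAlgebra.tprod_apply, ← Function.comp_def, ← List.map_ofFn, List.ofFn_get]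
    induction u with
    | nil => rfl
    | cons r u ih => rw [tword_cons, ih, List.map_cons, List.prod_cons]
  rw [h, WordLinear.lift, LinearMap.comp_apply]
  have h2 : TensorAlgebra.equivDirectSum.toLinearMap (TensorAlgebra.tprod K R u.length u.get) =
      DirectSum.of (fun n => TensorPower K n R) _ (PiTensorProduct.tprod K u.get) :=
    TensorAlgebra.toDirectSum_tensorPower_tprod u.get
  rw [h2]
  refine (DirectSum.toModule_lof K u.length _).trans ?_
  rw [PiTensorProduct.lift.tprod]
  change g (List.ofFn u.get) = g u
  rw [List.ofFn_get]

end LiftWords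
end WordLinear

/-! ### Maps out of the tensor algebra, multiplicative for `·` -/

section DotLift

variable {K R A : Type*} [Field K] [AddCommGroup R] [Module K R] [Ring A] [Algebra K A]
  [TwoAssocAlgebra K A]

/-- The extension of a linear map `R → A` to the tensor algebra, multiplicative for the
product `·` of `A`. -/
noncomputable def dotLift (f : R →ₗ[K] A) : TensorAlgebra K R →ₗ[K] A :=
  (DotAlg.of K A).symm.toLinearMap ∘ₗ
    (TensorAlgebra.lift K ((DotAlg.of K A).toLinearMap ∘ₗ f)).toLinearMap

theorem dotLift_one (f : R →ₗ[K] A) : dotLift f 1 = 1 :=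
  map_one (TensorAlgebra.lift K ((DotAlg.of K A).toLinearMap ∘ₗ f))

theorem dotLift_ι (f : R →ₗ[K] A) (r : R) : dotLift f (TensorAlgebra.ι K r) = f r :=
  TensorAlgebra.lift_ι_apply ((DotAlg.of K A).toLinearMap ∘ₗ f) r

theorem dotLift_mul (f : R →ₗ[K] A) (x y : TensorAlgebra K R) :
    dotLift f (x * y) = TwoAssocAlgebra.dot (K := K) (dotLift f x) (dotLift f y) :=
  map_mul (TensorAlgebra.lift K ((DotAlg.of K A).toLinearMap ∘ₗ f)) x y

theorem dotLift_tword (f : R →ₗ[K] A) (u : List R) :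
    dotLift f (tword K u) = dotProd K (u.map f) := by
  induction u with
  | nil => exact dotLift_one f
  | cons r u ih => rw [tword_cons, dotLift_mul, dotLift_ι, ih, List.map_cons, dotProd_cons]

variable {B : Type*} [Ring B] [Algebra K B] [TwoAssocAlgebra K B]

theorem map_tensorDot (g : A →ₗ[K] B) (hg : ∀ x y, g (TwoAssocAlgebra.dot (K := K) x y) =
    TwoAssocAlgebra.dot (K := K) (g x) (g y)) (s t : A ⊗[K] A) :
    TensorProduct.map g g (tensorDot K A s t) =
      tensorDot K B (TensorProduct.map g g s) (TensorProduct.map g g t) := by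
  induction s with
  | zero => simp
  | add s s' h h' => simp only [map_add, LinearMap.add_apply, h, h']
  | tmul a b =>
    induction t with
    | zero => simp
    | add s s' h h' => simp only [map_add, h, h']
    | tmul c d => simp [hg]

/-- The infinitesimal relation expresses `Δ (x · y)` through `Δ x` and `Δ y`, so a unital
`·`-morphism that respects the coproducts on `x` and `y` respects them on `x · y`. It is enough to
check generators. -/
theorem IsUnitalInfinitesimal.map_comul_dot {Δ : A →ₗ[K] A ⊗[K] A} {Δ' : B →ₗ[K] B ⊗[K] B}
    (hΔ : IsUnitalInfinitesimal K Δ) (hΔ' : IsUnitalInfinitesimal K Δ') (g : A →ₗ[K] B)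
    (hg1 : g 1 = 1) (hg : ∀ x y, g (TwoAssocAlgebra.dot (K := K) x y) =
      TwoAssocAlgebra.dot (K := K) (g x) (g y)) (x y : A)
    (hx : TensorProduct.map g g (Δ x) = Δ' (g x)) (hy : TensorProduct.map g g (Δ y) = Δ' (g y)) :
    TensorProduct.map g g (Δ (TwoAssocAlgebra.dot (K := K) x y)) =
      Δ' (g (TwoAssocAlgebra.dot (K := K) x y)) := by
  rw [hΔ, hg, hΔ', map_sub, map_add, map_tensorDot g hg, map_tensorDot g hg, hx, hy]
  simp [hg1]

/-- `T^c(R) → A` is a morphism of coalgebras if `R` is mapped to primitive elements. -/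
theorem map_deconcat_dotLift {Δ : A →ₗ[K] A ⊗[K] A} (hΔ : IsUnitalInfinitesimal K Δ)
    (h1 : Δ 1 = 1 ⊗ₜ 1) (f : R →ₗ[K] A) (hf : ∀ r, Δ (f r) = f r ⊗ₜ 1 + 1 ⊗ₜ f r) :
    TensorProduct.map (dotLift f) (dotLift f) ∘ₗ TensorCoalgebra.deconcat K R =
      Δ ∘ₗ dotLift f := by
  refine TensorCoalgebra.linearMap_ext_aux _ _ ?_ ?_ ?_
  · simp [TensorCoalgebra.deconcat_one, dotLift_one, h1]
  · intro r
    simp [TensorCoalgebra.deconcat_ι, dotLift_one, dotLift_ι, hf]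
  · intro x y hx hy
    exact (TensorCoalgebra.isUnitalInfinitesimal K R).map_comul_dot hΔ (dotLift f)
      (dotLift_one f) (dotLift_mul f) x y hx hy

theorem counit_dotLift {ε : A →ₗ[K] K} (hε : ∀ x y, ε (TwoAssocAlgebra.dot (K := K) x y) =
    ε x * ε y) (h1 : ε 1 = 1) (f : R →ₗ[K] A) (hf : ∀ r, ε (f r) = 0) :
    ε ∘ₗ dotLift f = TensorCoalgebra.counitAux K R := by
  refine TensorCoalgebra.linearMap_ext_aux _ _ ?_ ?_ ?_
  · simp [dotLift_one, h1, TensorCoalgebra.counitAux_one]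
  · intro r
    simp [dotLift_ι, hf, TensorCoalgebra.counitAux_ι]
  · intro x y hx hy
    rw [LinearMap.comp_apply] at *
    rw [dotLift_mul, hε, hx, hy]
    exact (TensorCoalgebra.counitAux_dot K R x y).symm

end DotLift

/-! ### Primitive and group-like elements of the tensor coalgebra -/

section TensorCoalgebraPrimitive

variable (K V : Type*) [Field K] [AddCommGroup V] [Module K V]

/-- `r` for the one-letter word `r`, zero for the other words. -/
def oneLetter {V : Type*} [Zero V] : List V → V
  | [v] => v
  | _ => 0

theorem oneLetter_of_length {V : Type*} [Zero V] (u : List V) (h : u.length ≠ 1) :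
    oneLetter u = 0 := by
  match u, h with
  | [], _ => rfl
  | _ :: _ :: _, _ => rfl

variable {V} in
theorem wordLinear_oneLetter : WordLinear K (oneLetter : List V → V) := by
  intro a b
  by_cases hab : a.length = 0 ∧ b.length = 0
  · rw [List.length_eq_zero_iff.mp hab.1, List.length_eq_zero_iff.mp hab.2]
    exact ⟨fun _ _ => rfl, fun _ _ => rfl⟩
  · have : ∀ x, oneLetter (a ++ x :: b) = 0 := fun x =>
      oneLetter_of_length _ (by simp only [List.length_append, List.length_cons]; omega)
    simpa only [this] using isLinearMap_zero K

namespace TensorCoalgebra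

/-- The projection `T^c(V) → V`. -/
noncomputable def proj : TensorAlgebra K V →ₗ[K] V := (wordLinear_oneLetter K).lift

theorem proj_tword (u : List V) : proj K V (tword K u) = oneLetter u :=
  WordLinear.lift_tword _ u

theorem proj_ι (v : V) : proj K V (TensorAlgebra.ι K v) = v := by
  rw [← tword_singleton, proj_tword]; rfl

theorem proj_one : proj K V 1 = 0 := proj_tword K V []

theorem deconcat_tword (u : List V) : deconcat K V (tword K u) =
    ∑ i ∈ Finset.range (u.length + 1), tword K (u.take i) ⊗ₜ[K] tword K (u.drop i) := by
  have h : ∀ w : List V, tword K w = word K V w := by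
    intro w
    induction w with
    | nil => rfl
    | cons r w ih => rw [tword_cons, ih]; rfl
  simp only [h]
  exact comul_word K V u

/-- `v₁ ⋯ v_n ↦ v₁ ⊗ v₂ ⋯ v_n`. -/
noncomputable def uncons : TensorAlgebra K V →ₗ[K] V ⊗[K] TensorAlgebra K V :=
  (proj K V).rTensor _ ∘ₗ deconcat K V

theorem uncons_one : uncons K V 1 = 0 := by
  simp [uncons, deconcat_one, proj_one]

theorem uncons_tword_cons (v : V) (u : List V) :
    uncons K V (tword K (v :: u)) = v ⊗ₜ tword K u := by
  rw [uncons, LinearMap.comp_apply, deconcat_tword, map_sum, Finset.sum_eq_single 1]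
  · rw [LinearMap.rTensor_tmul, proj_tword]; rfl
  · intro i hi hne
    rw [LinearMap.rTensor_tmul, proj_tword, oneLetter_of_length, TensorProduct.zero_tmul]
    simp only [Finset.mem_range, List.length_cons] at hi
    simp only [List.length_take, List.length_cons]
    omega
  · simp

/-- `v ⊗ x ↦ v x`. -/
noncomputable def consMap : V ⊗[K] TensorAlgebra K V →ₗ[K] TensorAlgebra K V :=
  LinearMap.mul' K _ ∘ₗ (TensorAlgebra.ι K).rTensor _

/-- Removing the first letter and putting it back recovers every nonempty word and kills the empty
one. So an element is known from its `uncons` up to its constant term. -/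
theorem consMap_uncons (x : TensorAlgebra K V) :
    consMap K V (uncons K V x) = x - counitAux K V x • 1 := by
  have : consMap K V ∘ₗ uncons K V = LinearMap.id - (counitAux K V).smulRight 1 := by
    refine tensorAlgebra_linear_ext fun u => ?_
    cases u with
    | nil => simp [uncons_one, counitAux_one]
    | cons v u =>
      rw [LinearMap.comp_apply, uncons_tword_cons]
      have := counitAux_dot K V (TensorAlgebra.ι K v) (tword K u)
      rw [counitAux_ι, zero_mul] at this
      simp only [LinearMap.sub_apply, LinearMap.smulRight_apply, tword_cons]
      erw [this]
      simp [consMap]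
  exact LinearMap.congr_fun this x

variable {K V}

/-- For primitive `x`, `uncons` sees only `proj x ⊗ 1`, because `proj` vanishes on `1`. The counit
of `x` is zero, so reassembling gives back `x` as a single letter. -/
theorem eq_ι_of_primitive (x : TensorAlgebra K V) (h : deconcat K V x = x ⊗ₜ 1 + 1 ⊗ₜ x) :
    x = TensorAlgebra.ι K (proj K V x) := by
  have h0 : counitAux K V x = 0 := by
    have := LinearMap.congr_fun (rTensor_counit_aux K V) x
    rw [LinearMap.comp_apply, h] at this
    simp only [map_add, LinearMap.rTensor_tmul, counitAux_one, TensorProduct.mk_apply,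
      add_eq_right] at this
    -- What remains is `ε(x) ⊗ 1 = 0`; applying the counit to the second factor extracts the scalar.
    have := congrArg ((TensorProduct.lid K K).toLinearMap ∘ₗ (counitAux K V).lTensor K) this
    simpa [counitAux_one] using this
  have := consMap_uncons K V x
  rw [h0, zero_smul, sub_zero, uncons, LinearMap.comp_apply, h] at this
  simpa [proj_one, consMap] using this.symm

/-- `v₁ ⋯ v_n ↦ f(v₁) v₂ ⋯ v_n`. -/
noncomputable def contract (f : Module.Dual K V) : Module.End K (TensorAlgebra K V) :=
  (TensorProduct.lid K _).toLinearMap ∘ₗ f.rTensor _ ∘ₗ uncons K V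

/-- Each application strips one letter, so a word of length `n` is killed by the power `n + 1`. The
exponent depends on the element: this is local nilpotency. -/
theorem contract_nilpotent (f : Module.Dual K V) (x : TensorAlgebra K V) :
    ∃ n, ((contract f) ^ n) x = 0 := by
  have hx : x ∈ Submodule.span K (Set.range (tword K : List V → TensorAlgebra K V)) := by
    rw [span_tword]; trivial
  induction hx using Submodule.span_induction with
  | mem x h =>
    obtain ⟨u, rfl⟩ := h
    induction u with
    | nil => exact ⟨1, by simp [contract, uncons_one]⟩
    | cons v u ih =>
      obtain ⟨n, hn⟩ := ih
      refine ⟨n + 1, ?_⟩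
      rw [pow_succ, Module.End.mul_apply, contract, LinearMap.comp_apply, LinearMap.comp_apply,
        uncons_tword_cons, LinearMap.rTensor_tmul]
      simp only [LinearEquiv.coe_coe, TensorProduct.lid_tmul, map_smul]
      rw [contract] at hn
      rw [hn, smul_zero]
  | zero => exact ⟨0, by simp⟩
  | add x y _ _ hx hy =>
    obtain ⟨n, hn⟩ := hx
    obtain ⟨m, hm⟩ := hy
    refine ⟨n + m, ?_⟩
    rw [map_add, pow_add, Module.End.mul_apply, Module.End.mul_apply, hm, map_zero, add_zero,
      ← Module.End.mul_apply, ← pow_add, add_comm, pow_add, Module.End.mul_apply, hn, map_zero]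
  | smul c x _ hx =>
    obtain ⟨n, hn⟩ := hx
    exact ⟨n, by rw [map_smul, hn, smul_zero]⟩

/-- A group-like `g` is an eigenvector of every `contract f`, with eigenvalue `f (proj g)`. Local
nilpotency forces the eigenvalue to be zero, so `proj g = 0`, hence `uncons g = 0` and `g` is its
constant term. This is what makes coalgebra isomorphisms with `T^c(V)` preserve the unit of a
bialgebra. -/
theorem eq_one_of_groupLike (g : TensorAlgebra K V) (h : deconcat K V g = g ⊗ₜ g)
    (h1 : counitAux K V g = 1) : g = 1 := by
  have hg : g ≠ 0 := by rintro rfl; simp at h1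
  have hp : proj K V g = 0 := by
    rw [← Module.forall_dual_apply_eq_zero_iff K]
    intro f
    have hD : contract f g = f (proj K V g) • g := by
      simp [contract, uncons, h]
    obtain ⟨n, hn⟩ := contract_nilpotent f g
    have hD' : ((contract f) ^ n) g = f (proj K V g) ^ n • g := by
      clear hn
      induction n with
      | zero => simp
      | succ n ih => rw [pow_succ, Module.End.mul_apply, hD, map_smul, ih, smul_smul, pow_succ']
    rw [hD', smul_eq_zero] at hn
    exact eq_zero_of_pow_eq_zero (hn.resolve_right hg)
  have := consMap_uncons K V g
  rw [h1, uncons, LinearMap.comp_apply, h, LinearMap.rTensor_tmul, hp, TensorProduct.zero_tmul,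
    map_zero, one_smul] at this
  exact (sub_eq_zero.mp this.symm)

end TensorCoalgebra

end TensorCoalgebraPrimitive

/-! ### The `B_∞` relations extended to empty words -/

section OpProps

variable {K R : Type*} [Field K] [AddCommGroup R] [Module K R]

theorem WordLinear.cons {X : Type*} [AddCommGroup X] [Module K X] {F : List R → X}
    (hF : WordLinear K F) (r : R) : WordLinear K fun w => F (r :: w) :=
  fun a b => hF (r :: a) b

theorem WordLinear.zero_cons {X : Type*} [AddCommGroup X] [Module K X] {F : List R → X}
    (hF : WordLinear K F) (w : List R) : F (0 :: w) = 0 :=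
  ((hF [] w).mk' _).map_zero

theorem fullSum_of_pos {R X : Type*} [AddCommMonoid X] (op : List R → List R → R) (u v : List R)
    (hu : 0 < u.length) (F : List R → X) :
    fullSum op u v F = ∑ k ∈ Finset.Icc 1 (u.length + v.length), blockSum op k u v F := by
  rw [fullSum, Finset.range_eq_Ico, Finset.sum_eq_sum_Ico_succ_bot (by omega), blockSum,
    if_neg (by omega), zero_add]
  rfl

/-- Only cuttings into a single block produce one-letter words. -/
theorem fullSum_oneLetter (op : List R → List R → R) (h0 : op [] [] = 0) (u v : List R) :
    fullSum op u v oneLetter = op u v := by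
  by_cases huv : u.length = 0 ∧ v.length = 0
  · rw [List.length_eq_zero_iff.mp huv.1, List.length_eq_zero_iff.mp huv.2, fullSum_nil, h0]; rfl
  · rw [fullSum, Finset.sum_eq_single 1]
    · rw [blockSum_one _ _ _ _ huv]; rfl
    · intro k _ hk
      rw [blockSum_congr_length op k u v oneLetter (fun _ => 0), blockSum_zero]
      intro w hw
      exact oneLetter_of_length w (by omega)
    · simp only [Finset.mem_range]; omega

/-- Against the empty word, `op` vanishes on every block except single letters, and `F` vanishes on
words with a zero letter. Only the cutting of `v` into its letters survives. -/
theorem fullSum_nil_left {X : Type*} [AddCommGroup X] [Module K X] (op : List R → List R → R)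
    (h : ∀ v, op [] v = oneLetter v) (v : List R) (F : List R → X) (hF : WordLinear K F) :
    fullSum op [] v F = F v := by
  induction v generalizing F with
  | nil => simp
  | cons r v ih =>
    rw [fullSum_rec _ _ _ _ (by simp)]
    simp only [cutSum, List.length_nil, zero_add, Finset.sum_range_one, true_and, List.take_nil,
      List.drop_nil]
    rw [Finset.sum_eq_single 1]
    · simp [ih _ (hF.cons r), h, oneLetter]
    · intro j hj hne
      simp only [Finset.mem_range, List.length_cons] at hj
      split_ifs with h0
      · rfl
      · rw [h, oneLetter_of_length]
        · simp only [hF.zero_cons, fullSum_zero]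
        · simp only [List.length_take, List.length_cons]; omega
    · simp

theorem fullSum_swap {R S X : Type*} [AddCommMonoid X] (m : List R → List R → S) (u v : List R)
    (F : List S → X) : fullSum m u v F = fullSum (fun a b => m b a) v u F := by
  simp only [fullSum, blockSum_swap m, add_comm u.length]

theorem fullSum_nil_right {X : Type*} [AddCommGroup X] [Module K X] (op : List R → List R → R)
    (h : ∀ u, op u [] = oneLetter u) (u : List R) (F : List R → X) (hF : WordLinear K F) :
    fullSum op u [] F = F u := by
  rw [fullSum_swap]
  exact fullSum_nil_left _ h u F hF

variable [BInfinityAlgebra K R]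

namespace BInfinityAlgebra

variable (K)

theorem op_nil_nil : op K ([] : List R) [] = 0 := by
  change M (K := K) 0 0 _ _ = (0 : R)
  rw [M_zero_zero]; rfl

theorem op_nil_right (u : List R) : op K u [] = oneLetter u := by
  match u with
  | [] => exact op_nil_nil K
  | [r] => exact M_one_zero (K := K) _ _
  | r :: s :: u =>
    change M (K := K) (u.length + 2) 0 _ _ = (0 : R)
    rw [M_left_zero _ (by omega)]; rfl

theorem op_nil_left (v : List R) : op K [] v = oneLetter v := by
  match v with
  | [] => exact op_nil_nil K
  | [r] => exact M_zero_one (K := K) _ _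
  | r :: s :: v =>
    change M (K := K) 0 (v.length + 2) _ _ = (0 : R)
    rw [M_zero_right _ (by omega)]; rfl

theorem wordLinear_op_left (v : List R) : WordLinear K fun u : List R => op K u v :=
  (wordLinear_of_multilinear fun n => M (K := K) n v.length).comp
    ({ toFun := fun F => F v.get
       map_add' := fun _ _ => rfl
       map_smul' := fun _ _ => rfl } : MultilinearMap K (fun _ : Fin v.length => R) R →ₗ[K] R)

theorem wordLinear_op_right (u : List R) : WordLinear K fun v : List R => op K u v :=
  wordLinear_of_multilinear fun n => M (K := K) u.length n u.get

theorem fullSum_op_nil_left {X : Type*} [AddCommGroup X] [Module K X] (v : List R)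
    (F : List R → X) (hF : WordLinear K F) : fullSum (op K) [] v F = F v :=
  fullSum_nil_left _ (op_nil_left K) v F hF

theorem fullSum_op_nil_right {X : Type*} [AddCommGroup X] [Module K X] (u : List R)
    (F : List R → X) (hF : WordLinear K F) : fullSum (op K) u [] F = F u :=
  fullSum_nil_right _ (op_nil_right K) u F hF

/-- The relations of a `B_∞`-algebra, for words of any length. -/
theorem fullSum_op (u v w : List R) :
    fullSum (op K) u v (fun x => op K x w) = fullSum (op K) v w (fun x => op K u x) := by
  by_cases hu : u.length = 0
  · obtain rfl := List.length_eq_zero_iff.mp hu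
    -- For empty `u` both sides reduce to `op v w`: on the left `v` is cut into its letters, on the
    -- right `op [] x` keeps only one-letter words `x`.
    rw [fullSum_op_nil_left K _ _ (wordLinear_op_left K w)]
    simp only [op_nil_left]
    exact (fullSum_oneLetter _ (op_nil_nil K) v w).symm
  by_cases hv : v.length = 0
  · obtain rfl := List.length_eq_zero_iff.mp hv
    rw [fullSum_op_nil_left K _ _ (wordLinear_op_right K u),
      fullSum_op_nil_right K _ _ (wordLinear_op_left K w)]
  by_cases hw : w.length = 0
  · obtain rfl := List.length_eq_zero_iff.mp hw
    rw [fullSum_op_nil_right K _ _ (wordLinear_op_right K u)]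
    simp only [op_nil_right]
    exact fullSum_oneLetter _ (op_nil_nil K) u v
  · rw [fullSum_of_pos _ _ _ (by omega), fullSum_of_pos _ _ _ (by omega)]
    exact rel u v w (by omega) (by omega) (by omega)

end BInfinityAlgebra

end OpProps

/-! ### The product `*` on the tensor module of a `B_∞`-algebra -/

section Star

open BInfinityAlgebra

variable (K R : Type*) [Field K] [AddCommGroup R] [Module K R] [BInfinityAlgebra K R]

/-- The product `*` on the tensor module over a `B_∞`-algebra, on words. -/
def starWord (u v : List R) : TensorAlgebra K R := fullSum (op K) u v (tword K)

theorem wordLinear_starWord_right (u : List R) : WordLinear K (starWord K R u) :=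
  WordLinear.fullSum_right (wordLinear_op_right K) u _ wordLinear_tword

theorem wordLinear_starWord_lift :
    WordLinear K fun u => (wordLinear_starWord_right K R u).lift := by
  have h : ∀ v, WordLinear K fun u => starWord K R u v := fun v =>
    WordLinear.fullSum_left (wordLinear_op_left K) v _ wordLinear_tword
  intro a b
  constructor
  · intro x y
    refine tensorAlgebra_linear_ext fun v => ?_
    simp only [LinearMap.add_apply, WordLinear.lift_tword]
    exact (h v a b).map_add x y
  · intro c x
    refine tensorAlgebra_linear_ext fun v => ?_
    simp only [LinearMap.smul_apply, WordLinear.lift_tword]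
    exact (h v a b).map_smul c x

/-- The product `*` on the tensor module over a `B_∞`-algebra. -/
noncomputable def star : TensorAlgebra K R →ₗ[K] TensorAlgebra K R →ₗ[K] TensorAlgebra K R :=
  (wordLinear_starWord_lift K R).lift

theorem star_tword (u v : List R) : star K R (tword K u) (tword K v) = starWord K R u v := by
  rw [star, WordLinear.lift_tword, WordLinear.lift_tword]

theorem starWord_eq_totalSum (u v : List R) : starWord K R u v =
    totalSum K (fun a b => TensorAlgebra.ι K (op K a b)) u v :=
  (totalSum_eq_fullSum (TensorAlgebra.ι K) (op K) u v).symm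

theorem one_star (x : TensorAlgebra K R) : star K R 1 x = x := by
  have : star K R 1 = LinearMap.id := tensorAlgebra_linear_ext fun u => by
    rw [← tword_nil, star_tword, starWord, fullSum_op_nil_left K _ _ wordLinear_tword]; rfl
  rw [this]; rfl

theorem star_one (x : TensorAlgebra K R) : star K R x 1 = x := by
  have : (star K R).flip 1 = LinearMap.id := tensorAlgebra_linear_ext fun u => by
    rw [LinearMap.flip_apply, ← tword_nil, star_tword, starWord,
      fullSum_op_nil_right K _ _ wordLinear_tword]; rfl
  exact LinearMap.congr_fun this x

/-- Expanding the two bracketings over blocks gives `leftTriple` and `rightTriple`, which coincide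
by the `B_∞` relations. -/
theorem star_tword_assoc (u v w : List R) :
    star K R (star K R (tword K u) (tword K v)) (tword K w) =
      star K R (tword K u) (star K R (tword K v) (tword K w)) := by
  have h1 : star K R (star K R (tword K u) (tword K v)) (tword K w) =
      leftTriple K (TensorAlgebra.ι K) (op K) u v w := by
    rw [star_tword, starWord]
    refine (map_fullSum ((star K R).flip (tword K w)).toAddMonoidHom (op K) u v (tword K)).symm.trans
      ?_
    simp only [leftTriple, ← starWord_eq_totalSum, ← star_tword]
    rfl
  have h2 : star K R (tword K u) (star K R (tword K v) (tword K w)) =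
      rightTriple K (TensorAlgebra.ι K) (op K) u v w := by
    rw [star_tword, starWord]
    refine (map_fullSum (star K R (tword K u)).toAddMonoidHom (op K) v w (tword K)).symm.trans ?_
    simp only [rightTriple, ← starWord_eq_totalSum, ← star_tword]
    rfl
  rw [h1, h2, leftTriple_eq_rightTriple _ _ (op_nil_nil K) (fullSum_op K)]

theorem star_assoc (x y z : TensorAlgebra K R) :
    star K R (star K R x y) z = star K R x (star K R y z) := by
  -- Words are replaced by arbitrary elements one argument at a time, from right to left, each time
  -- comparing linear maps on words.
  have h1 : ∀ u v, star K R (star K R (tword K u) (tword K v)) =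
      star K R (tword K u) ∘ₗ star K R (tword K v) := fun u v =>
    tensorAlgebra_linear_ext fun w => star_tword_assoc K R u v w
  have h2 : ∀ u, (star K R).flip z ∘ₗ star K R (tword K u) =
      star K R (tword K u) ∘ₗ (star K R).flip z := fun u =>
    tensorAlgebra_linear_ext fun v => LinearMap.congr_fun (h1 u v) z
  have h3 : (star K R).flip z ∘ₗ (star K R).flip y = (star K R).flip (star K R y z) :=
    tensorAlgebra_linear_ext fun u => LinearMap.congr_fun (h2 u) y
  exact LinearMap.congr_fun h3 x

/-- The tensor module over a `B_∞`-algebra, as a 2-associative algebra for the product `*`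
defined by the operations and the concatenation product. -/
def StarAlg := TensorAlgebra K R

namespace StarAlg

instance : AddCommGroup (StarAlg K R) := inferInstanceAs (AddCommGroup (TensorAlgebra K R))

instance : Module K (StarAlg K R) := inferInstanceAs (Module K (TensorAlgebra K R))

instance : One (StarAlg K R) := inferInstanceAs (One (TensorAlgebra K R))

noncomputable instance : Mul (StarAlg K R) := ⟨fun x y => star K R x y⟩

noncomputable instance : Ring (StarAlg K R) where
  __ := (inferInstance : AddCommGroup (StarAlg K R))
  mul_assoc x y z := star_assoc K R x y z
  one_mul x := one_star K R x
  mul_one x := star_one K R x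
  left_distrib x y z := map_add (star K R x) y z
  right_distrib x y z := LinearMap.map_add₂ (star K R) x y z
  zero_mul x := LinearMap.map_zero₂ (star K R) x
  mul_zero x := map_zero (star K R x)

noncomputable instance : Algebra K (StarAlg K R) :=
  Algebra.ofModule (fun c x y => LinearMap.map_smul₂ (star K R) c x y)
    (fun c x y => map_smul (star K R x) c y)

noncomputable instance : TwoAssocAlgebra K (StarAlg K R) where
  dot := LinearMap.mul K (TensorAlgebra K R)
  dot_assoc := mul_assoc (G := TensorAlgebra K R)
  one_dot := one_mul (M := TensorAlgebra K R)
  dot_one := mul_one (M := TensorAlgebra K R)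

/-- The inclusion of the one-letter words. -/
def ι : R →ₗ[K] StarAlg K R := TensorAlgebra.ι K

theorem dotProd_map_ι (u : List R) : dotProd K (u.map (ι K R)) = (tword K u : TensorAlgebra K R) := by
  induction u with
  | nil => rfl
  | cons r u ih => rw [List.map_cons, dotProd_cons, ih]; rfl

/-- The operations of a 2-associative algebra are characterized by the first-block recursion for
`*`-products of `·`-words (`eq_mPQ_of_cutSum`), and `*` was defined on words so that `op` satisfies
it. Hence the universal property of `U2(R)` applies to `StarAlg`. -/
theorem ι_op (u v : List R) : ι K R (op K u v) = mPQ K (u.map (ι K R)) (v.map (ι K R)) := by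
  refine eq_mPQ_of_cutSum K (ι K R) (fun u v => ι K R (op K u v)) (by simp [op_nil_nil]) ?_ u v
  intro u v huv
  have h : ∀ u v : List R, dotProd K (u.map (ι K R)) * dotProd K (v.map (ι K R)) =
      (totalSum K (fun a b => TensorAlgebra.ι K (op K a b)) u v : TensorAlgebra K R) := by
    intro u v
    rw [dotProd_map_ι, dotProd_map_ι, ← starWord_eq_totalSum, ← star_tword]
    rfl
  simp only [h]
  exact (totalSum_rec K (fun a b => TensorAlgebra.ι K (op K a b)) u v huv).symm

theorem dotLift_ι (x : TensorAlgebra K R) : dotLift (ι K R) x = x := by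
  have h : dotLift (ι K R) = (LinearMap.id : TensorAlgebra K R →ₗ[K] TensorAlgebra K R) :=
    tensorAlgebra_linear_ext fun u => (dotLift_tword _ u).trans (dotProd_map_ι K R u)
  exact LinearMap.congr_fun h x

end StarAlg

end Star

/-! ### `U2(R)` is the tensor coalgebra on `R` -/

section Enveloping

open BInfinityAlgebra

variable {K R : Type*} [Field K] [AddCommGroup R] [Module K R] [BInfinityAlgebra K R]

theorem blockSum_map_words {R R' S X : Type*} [AddCommMonoid X] (f : R → R')
    (m : List R' → List R' → S) (k : ℕ) (u v : List R) (F : List S → X) :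
    blockSum m k (u.map f) (v.map f) F =
      blockSum (fun a b => m (a.map f) (b.map f)) k u v F := by
  induction k generalizing u v F with
  | zero => simp [blockSum]
  | succ k ih => simp only [blockSum, List.length_map, ← List.map_take, ← List.map_drop, ih]

/-- Solving the recursive definition of `M_{pq}` for the `*`-product writes it as a sum of `·`-words
in the operations. When the operations stay in the image of `f`, so do the letters of these words.
-/
theorem dotProd_mul_dotProd {R A : Type*} [Ring A] [Algebra K A] [TwoAssocAlgebra K A]
    (f : R → A) (op : List R → List R → R)
    (hf : ∀ u v, f (op u v) = mPQ K (u.map f) (v.map f)) (u v : List R) :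
    dotProd K (u.map f) * dotProd K (v.map f) =
      fullSum op u v (fun x => dotProd K (x.map f)) := by
  rw [← totalSum_mPQ, ← totalSum_eq_fullSum]
  simp only [totalSum, List.length_map, blockSum_map_words, hf]

/-- The image contains the generators and is stable under sums and `·`. Stability under `*` is the
nontrivial point: the image is spanned by `·`-words in `R`, and a `*`-product of two such words is
again a sum of such words. -/
theorem dotLift_surjective : Function.Surjective (dotLift (U2.ι K R)) := by
  intro x
  rw [← LinearMap.mem_range]
  induction x using U2.induction with
  | hι r => exact ⟨_, dotLift_ι _ r⟩
  | hs c =>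
    rw [Algebra.algebraMap_eq_smul_one]
    exact Submodule.smul_mem _ _ ⟨1, dotLift_one _⟩
  | ha x y hx hy => exact Submodule.add_mem _ hx hy
  | hd x y hx hy =>
    obtain ⟨a, rfl⟩ := hx
    obtain ⟨b, rfl⟩ := hy
    exact ⟨a * b, dotLift_mul _ a b⟩
  | hm x y hx hy =>
    have hr : LinearMap.range (dotLift (U2.ι K R)) =
        Submodule.span K (Set.range fun u => dotLift (U2.ι K R) (tword K u)) := by
      rw [LinearMap.range_eq_map, ← span_tword, Submodule.map_span, ← Set.range_comp]
      rfl
    have h : x * y ∈ LinearMap.range (dotLift (U2.ι K R)) * LinearMap.range (dotLift (U2.ι K R)) :=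
      Submodule.mul_mem_mul hx hy
    rw [hr, Submodule.span_mul_span] at h
    refine Submodule.span_le.mpr ?_ h
    rintro _ ⟨_, ⟨u, rfl⟩, _, ⟨v, rfl⟩, rfl⟩
    refine ⟨fullSum (op K) u v (tword K), ?_⟩
    simp only [dotLift_tword]
    rw [dotProd_mul_dotProd _ _ (U2.ι_op K R)]
    simp only [← dotLift_tword]
    exact (map_fullSum (dotLift (U2.ι K R)).toAddMonoidHom (op K) u v (tword K)).symm

theorem lift_dotLift {B : Type*} [Ring B] [Algebra K B] [TwoAssocAlgebra K B] (f : R →ₗ[K] B)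
    (hf) (x : TensorAlgebra K R) : U2.lift f hf (dotLift (U2.ι K R) x) = dotLift f x := by
  have h : (U2.lift f hf).toLinearMap ∘ₗ dotLift (U2.ι K R) = dotLift f := by
    refine tensorAlgebra_linear_ext fun u => ?_
    rw [LinearMap.comp_apply, dotLift_tword, dotLift_tword]
    refine (map_dotProd (U2.lift f hf) (U2.lift_dot f hf) _).trans ?_
    rw [List.map_map]
    rfl
  exact LinearMap.congr_fun h x

/-- The map `U2(R) → StarAlg` given by the universal property is a left inverse, since on `StarAlg`
the product `·` is concatenation. -/
theorem dotLift_injective : Function.Injective (dotLift (U2.ι K R)) := by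
  intro x y h
  have := congrArg (U2.lift (StarAlg.ι K R) (StarAlg.ι_op K R)) h
  rwa [lift_dotLift, lift_dotLift, StarAlg.dotLift_ι, StarAlg.dotLift_ι] at this

variable (K R) in
/-- `U2(R)` is isomorphic to `T^c(R)` as a coalgebra. -/
noncomputable def tensorCoalgebraEquivU2 : TensorCoalgebra K R ≃ₗc[K] U2 K R :=
  CoalgEquiv.ofBijective (f := (
    { toLinearMap := dotLift (U2.ι K R)
      counit_comp := counit_dotLift (ε := (U2.counitAlgHom K R).toLinearMap)
        (U2.counitAlgHom_dot K R) (map_one (U2.counitAlgHom K R)) _ (fun _ => rfl)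
      map_comp_comul := map_deconcat_dotLift (U2.isUnitalInfinitesimal K R)
        (map_one (U2.comulAlgHom K R)) _ (U2.comulAlgHom_ι K R) } :
      TensorCoalgebra K R →ₗc[K] U2 K R)) ⟨dotLift_injective, dotLift_surjective⟩

end Enveloping

/-! ### The `B_∞`-structure on primitive elements -/

section Primitive

variable {K : Type*} [Field K]

/-- Multilinear operations on `R` from a function on pairs of words. -/
def multilinearOfWords {R : Type*} [AddCommGroup R] [Module K R] {op : List R → List R → R}
    (hl : ∀ v, WordLinear K fun u => op u v) (hr : ∀ u, WordLinear K fun v => op u v) (p q : ℕ) :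
    MultilinearMap K (fun _ : Fin p => R) (MultilinearMap K (fun _ : Fin q => R) R) :=
  WordLinear.toMultilinear (g := fun u => (hr u).toMultilinear q) (fun a b =>
    ⟨fun x y => by ext v; exact (hl (List.ofFn v) a b).map_add x y,
      fun c x => by ext v; exact (hl (List.ofFn v) a b).map_smul c x⟩) p

theorem evalWords_multilinearOfWords {R : Type*} [AddCommGroup R] [Module K R]
    {op : List R → List R → R} (hl : ∀ v, WordLinear K fun u => op u v)
    (hr : ∀ u, WordLinear K fun v => op u v) (u v : List R) :
    evalWords (multilinearOfWords hl hr) u v = op u v := by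
  change op (List.ofFn u.get) (List.ofFn v.get) = _
  rw [List.ofFn_get, List.ofFn_get]

variable {H : Type*} [Ring H] [Bialgebra K H]

theorem mem_primitivePart (x : H) : x ∈ primitivePart K H ↔
    Coalgebra.comul (R := K) x = x ⊗ₜ 1 + 1 ⊗ₜ x := Iff.rfl

variable [TwoAssocAlgebra K H]

/-- The graph map `x ↦ (x, Δ x)` is a morphism of 2-associative algebras into `UIExt`, so it
commutes with `M_{pq}`. On primitive arguments it agrees with `primExt`, for which `primExt_mPQ`
holds; comparing second components shows that the value is primitive. -/
theorem mPQ_mem_primitivePart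
    (hΔ : IsUnitalInfinitesimal K (Coalgebra.comul (R := K) (A := H))) (u v : List H)
    (hu : ∀ x ∈ u, x ∈ primitivePart K H) (hv : ∀ x ∈ v, x ∈ primitivePart K H) :
    mPQ K u v ∈ primitivePart K H := by
  let G : H →ₐ[K] UIExt K H := (AlgHom.id K H).prod (Bialgebra.comulAlgHom K H)
  have hG : ∀ w : List H, (∀ x ∈ w, x ∈ primitivePart K H) → w.map G = w.map (primExt K H) :=
    fun w hw => List.map_congr_left fun x hx => Prod.ext rfl ((mem_primitivePart x).mp (hw x hx))
  have h := map_mPQ G (fun x y => Prod.ext rfl (hΔ x y)) u v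
  rw [hG u hu, hG v hv, ← primExt_mPQ] at h
  exact congrArg Prod.snd h

variable {R : Type*} [AddCommGroup R] [Module K R] (f : R →ₗ[K] H) (g : H →ₗ[K] R)

/-- The operations `M_{pq}` of `H`, transported to `R`. -/
def inducedOp (u v : List R) : R := g (mPQ K (u.map f) (v.map f))

theorem map_inducedOp (hΔ : IsUnitalInfinitesimal K (Coalgebra.comul (R := K) (A := H)))
    (hf : ∀ r, f r ∈ primitivePart K H) (hfg : ∀ x ∈ primitivePart K H, f (g x) = x)
    (u v : List R) : f (inducedOp f g u v) = mPQ K (u.map f) (v.map f) := by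
  refine hfg _ (mPQ_mem_primitivePart hΔ _ _ ?_ ?_) <;>
  · intro x hx
    obtain ⟨r, _, rfl⟩ := List.mem_map.mp hx
    exact hf r

theorem wordLinear_inducedOp_left (v : List R) : WordLinear K fun u => inducedOp f g u v :=
  ((wordLinear_mPQ_left (v.map f)).map f).comp g

theorem wordLinear_inducedOp_right (u : List R) : WordLinear K fun v => inducedOp f g u v :=
  ((wordLinear_mPQ_right (u.map f)).map f).comp g

/-- The two triple products are the two bracketings of a `*`-product in `H`, so they are equal;
since `f` is injective, associativity gives back the relations. -/
theorem inducedOp_rel (hop : ∀ u v, f (inducedOp f g u v) = mPQ K (u.map f) (v.map f))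
    (hgf : ∀ r, g (f r) = r) (u v w : List R) :
    fullSum (inducedOp f g) u v (fun x => inducedOp f g x w) =
      fullSum (inducedOp f g) v w (fun x => inducedOp f g u x) := by
  have h0 : inducedOp f g [] [] = 0 := by simp [inducedOp]
  refine fullSum_eq_of_leftTriple_eq f _ h0 (Function.LeftInverse.injective hgf) ?_ u v w
  intro u v w
  simp only [leftTriple, rightTriple]
  have ht : ∀ u v, totalSum K (fun a b => f (inducedOp f g a b)) u v =
      dotProd K (u.map f) * dotProd K (v.map f) := fun u v => by
    rw [dotProd_mul_dotProd f _ hop]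
    exact totalSum_eq_fullSum f _ u v
  simp only [ht]
  have h1 := map_fullSum (AddMonoidHom.mulRight (dotProd K (w.map f))) (inducedOp f g) u v
    (fun x => dotProd K (x.map f))
  have h2 := map_fullSum (AddMonoidHom.mulLeft (dotProd K (u.map f))) (inducedOp f g) v w
    (fun x => dotProd K (x.map f))
  rw [← dotProd_mul_dotProd f _ hop] at h1 h2
  exact h1.trans ((mul_assoc _ _ _).trans h2.symm)

/-- The `B_∞`-algebra of primitive elements. -/
@[reducible] def inducedBInfinity (hop : ∀ u v, f (inducedOp f g u v) = mPQ K (u.map f) (v.map f))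
    (hgf : ∀ r, g (f r) = r) : BInfinityAlgebra K R where
  M := multilinearOfWords (wordLinear_inducedOp_left f g) (wordLinear_inducedOp_right f g)
  M_zero_zero := by
    ext u v
    change g (mPQ K [] []) = 0
    simp
  M_one_zero u v := by
    change g (mPQ K ((List.ofFn u).map f) []) = u 0
    simp [mPQ_one_zero, hgf]
  M_zero_one u v := by
    change g (mPQ K [] ((List.ofFn v).map f)) = v 0
    simp [mPQ_zero_one, hgf]
  M_left_zero n hn := by
    ext u v
    change g (mPQ K ((List.ofFn u).map f) []) = 0
    rw [mPQ_left_zero K _ (by simpa using hn), map_zero]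
  M_zero_right n hn := by
    ext u v
    change g (mPQ K [] ((List.ofFn v).map f)) = 0
    rw [mPQ_zero_right K _ (by simpa using hn), map_zero]
  rel u v w hu hv hw := by
    have h : evalWords (multilinearOfWords (wordLinear_inducedOp_left f g)
        (wordLinear_inducedOp_right f g)) = inducedOp f g := by
      funext u v
      exact evalWords_multilinearOfWords _ _ u v
    rw [h, ← fullSum_of_pos _ _ _ hu, ← fullSum_of_pos _ _ _ hv]
    exact inducedOp_rel f g hop hgf u v w

theorem op_inducedBInfinity (hop : ∀ u v, f (inducedOp f g u v) = mPQ K (u.map f) (v.map f))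
    (hgf : ∀ r, g (f r) = r) (u v : List R) :
    letI := inducedBInfinity f g hop hgf
    BInfinityAlgebra.op K u v = inducedOp f g u v :=
  evalWords_multilinearOfWords _ _ u v

/-- A 2-associative bialgebra that is free, for the product `·`, on its primitive part is the
enveloping algebra of a `B_∞`-algebra. -/
theorem exists_bialgEquiv_U2 (hΔ : IsUnitalInfinitesimal K (Coalgebra.comul (R := K) (A := H)))
    (hε : ∀ x y : H, Coalgebra.counit (R := K) (TwoAssocAlgebra.dot (K := K) x y) =
      Coalgebra.counit (R := K) x * Coalgebra.counit (R := K) y)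
    (hf : ∀ r, f r ∈ primitivePart K H) (hfε : ∀ r, Coalgebra.counit (R := K) (f r) = 0)
    (hfg : ∀ x ∈ primitivePart K H, f (g x) = x)
    (hgf : ∀ r, g (f r) = r) (hbij : Function.Bijective (dotLift f)) :
    ∃ _ : BInfinityAlgebra K R, Nonempty (H ≃ₐc[K] U2 K R) := by
  have hop := map_inducedOp f g hΔ hf hfg
  let _i := inducedBInfinity f g hop hgf
  have hlift : ∀ u v : List R, f (BInfinityAlgebra.op K u v) = mPQ K (u.map f) (v.map f) :=
    fun u v => (congrArg f (op_inducedBInfinity f g hop hgf u v)).trans (hop u v)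
  -- By `lift_dotLift`, the lift composed with the surjection from the tensor algebra onto `U2(R)`
  -- is the bijection `dotLift f`.
  have hb : Function.Bijective (U2.lift f hlift) := by
    constructor
    · intro x y hxy
      obtain ⟨x, rfl⟩ := dotLift_surjective x
      obtain ⟨y, rfl⟩ := dotLift_surjective y
      rw [lift_dotLift, lift_dotLift] at hxy
      rw [hbij.1 hxy]
    · intro y
      obtain ⟨x, rfl⟩ := hbij.2 y
      exact ⟨_, lift_dotLift f hlift x⟩
  refine ⟨_i, ⟨(BialgEquiv.ofAlgEquiv (AlgEquiv.ofBijective (U2.lift f hlift) hb) ?_ ?_).symm⟩⟩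
  · ext x
    change Coalgebra.counit (R := K) (U2.lift f hlift x) = U2.counitAlgHom K R x
    induction x using U2.induction with
    | hι r => exact hfε r
    | hs c => simp
    | ha x y hx hy => simp only [map_add, hx, hy]
    | hm x y hx hy => simp only [map_mul, Bialgebra.counit_mul, hx, hy]
    | hd x y hx hy =>
      rw [U2.lift_dot, hε, hx, hy]
      exact (U2.counitAlgHom_dot K R x y).symm
  · ext x
    change TensorProduct.map (U2.lift f hlift).toLinearMap (U2.lift f hlift).toLinearMap
      (U2.comulAlgHom K R x) = Coalgebra.comul (R := K) (U2.lift f hlift x)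
    induction x using U2.induction with
    | hι r =>
      rw [U2.comulAlgHom_ι, U2.lift_ι, (mem_primitivePart _).mp (hf r)]
      simp [U2.lift_ι]
    | hs c => simp [Algebra.TensorProduct.algebraMap_apply]
    | ha x y hx hy => simp only [map_add, hx, hy]
    | hm x y hx hy =>
      rw [map_mul, map_mul (U2.lift f hlift), Bialgebra.comul_mul, ← hx, ← hy]
      exact map_mul (Algebra.TensorProduct.map (U2.lift f hlift) (U2.lift f hlift)) _ _
    -- For `·`-products, both coproducts obey the infinitesimal relation and the lift preserves `·`.
    | hd x y hx hy =>
      exact (U2.isUnitalInfinitesimal K R).map_comul_dot hΔ (U2.lift f hlift).toLinearMap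
        (map_one (U2.lift f hlift)) (U2.lift_dot f hlift) x y hx hy

end Primitive

/-! ### Cofree bialgebras are enveloping algebras -/

section Cofree

variable {K : Type*} [Field K] {H : Type*} [Ring H] [Bialgebra K H]
  {V : Type*} [AddCommGroup V] [Module K V] (φ : H ≃ₗc[K] TensorCoalgebra K V)

/-- The underlying linear equivalence with the tensor algebra. -/
noncomputable def toTensorAlgebra : H ≃ₗ[K] TensorAlgebra K V := φ.toLinearEquiv

theorem deconcat_toTensorAlgebra (x : H) :
    TensorCoalgebra.deconcat K V (toTensorAlgebra φ x) =
      TensorProduct.map (toTensorAlgebra φ).toLinearMap (toTensorAlgebra φ).toLinearMap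
        (Coalgebra.comul (R := K) x) :=
  (LinearMap.congr_fun (CoalgHomClass.map_comp_comul φ) x).symm

theorem counit_toTensorAlgebra (x : H) :
    TensorCoalgebra.counitAux K V (toTensorAlgebra φ x) = Coalgebra.counit (R := K) x :=
  LinearMap.congr_fun (CoalgHomClass.counit_comp φ) x

/-- The isomorphism is only one of coalgebras, but it carries `1` to a group-like element with
counit `1`, and `T^c(V)` has no such element besides its own `1`. -/
theorem toTensorAlgebra_one : toTensorAlgebra φ 1 = 1 :=
  TensorCoalgebra.eq_one_of_groupLike _
    (by rw [deconcat_toTensorAlgebra]; simp [Algebra.TensorProduct.one_def])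
    (by rw [counit_toTensorAlgebra]; simp)

theorem toTensorAlgebra_symm_one : (toTensorAlgebra φ).symm 1 = 1 := by
  rw [LinearEquiv.symm_apply_eq, toTensorAlgebra_one]

theorem toTensorAlgebra_of_primitive (x : H) (hx : x ∈ primitivePart K H) :
    toTensorAlgebra φ x = TensorAlgebra.ι K (TensorCoalgebra.proj K V (toTensorAlgebra φ x)) := by
  refine TensorCoalgebra.eq_ι_of_primitive _ ?_
  rw [deconcat_toTensorAlgebra, (mem_primitivePart x).mp hx]
  simp [toTensorAlgebra_one]

theorem comul_toTensorAlgebra_symm (x : TensorAlgebra K V) :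
    Coalgebra.comul (R := K) ((toTensorAlgebra φ).symm x) =
      TensorProduct.map (toTensorAlgebra φ).symm.toLinearMap (toTensorAlgebra φ).symm.toLinearMap
        (TensorCoalgebra.deconcat K V x) := by
  obtain ⟨x, rfl⟩ := (toTensorAlgebra φ).surjective x
  rw [deconcat_toTensorAlgebra, ← LinearMap.comp_apply, ← TensorProduct.map_comp]
  simp

theorem symm_ι_mem_primitivePart (v : V) :
    (toTensorAlgebra φ).symm (TensorAlgebra.ι K v) ∈ primitivePart K H := by
  rw [mem_primitivePart, comul_toTensorAlgebra_symm, TensorCoalgebra.deconcat_ι]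
  simp [toTensorAlgebra_symm_one]

/-- The primitive part of a bialgebra isomorphic to `T^c(V)` as a coalgebra is `V`. -/
noncomputable def primitivePartEquiv : primitivePart K H ≃ₗ[K] V where
  toLinearMap := TensorCoalgebra.proj K V ∘ₗ (toTensorAlgebra φ).toLinearMap ∘ₗ
    (primitivePart K H).subtype
  invFun v := ⟨(toTensorAlgebra φ).symm (TensorAlgebra.ι K v), symm_ι_mem_primitivePart φ v⟩
  left_inv x := Subtype.ext ((LinearEquiv.symm_apply_eq _).mpr
    (toTensorAlgebra_of_primitive φ x x.2).symm)
  right_inv v := by simp [TensorCoalgebra.proj_ι]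

theorem tensorAlgebra_dotLift_comp {W X : Type*} [AddCommGroup W] [Module K W] [AddCommGroup X]
    [Module K X] (e : V →ₗ[K] W) (e' : W →ₗ[K] X) (x : TensorAlgebra K V) :
    dotLift (TensorAlgebra.ι K ∘ₗ e') (dotLift (TensorAlgebra.ι K ∘ₗ e) x) =
      dotLift (TensorAlgebra.ι K ∘ₗ e' ∘ₗ e) x := by
  have h : dotLift (TensorAlgebra.ι K ∘ₗ e') ∘ₗ dotLift (TensorAlgebra.ι K ∘ₗ e) =
      dotLift (TensorAlgebra.ι K ∘ₗ e' ∘ₗ e) := by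
    refine TensorCoalgebra.linearMap_ext_aux _ _ (by simp [dotLift_one])
      (fun v => by simp [dotLift_ι]) fun x y hx hy => ?_
    rw [LinearMap.comp_apply] at *
    rw [dotLift_mul, dotLift_mul, ← hx, ← hy]
    exact dotLift_mul _ _ _
  exact LinearMap.congr_fun h x

theorem tensorAlgebra_dotLift_ι (x : TensorAlgebra K V) : dotLift (TensorAlgebra.ι K) x = x := by
  have h : dotLift (TensorAlgebra.ι K) = (LinearMap.id : TensorAlgebra K V →ₗ[K] _) :=
    tensorAlgebra_linear_ext fun u => dotLift_tword _ u
  exact LinearMap.congr_fun h x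

/-- `T^c` is functorial for linear equivalences. -/
noncomputable def tensorCoalgebraCongr {W : Type*} [AddCommGroup W] [Module K W] (e : V ≃ₗ[K] W) :
    TensorCoalgebra K V ≃ₗc[K] TensorCoalgebra K W :=
  CoalgEquiv.ofBijective (f := (
    { toLinearMap := dotLift (TensorAlgebra.ι K ∘ₗ e.toLinearMap)
      counit_comp := counit_dotLift (TensorCoalgebra.counitAux_dot K W)
        (TensorCoalgebra.counitAux_one K W) _ (fun v => TensorCoalgebra.counitAux_ι K W (e v))
      map_comp_comul := map_deconcat_dotLift (TensorCoalgebra.isUnitalInfinitesimal K W)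
        (TensorCoalgebra.deconcat_one K W) _ (fun v => TensorCoalgebra.deconcat_ι K W (e v)) } :
      TensorCoalgebra K V →ₗc[K] TensorCoalgebra K W))
    (by
      refine Function.bijective_iff_has_inverse.mpr
        ⟨dotLift (TensorAlgebra.ι K ∘ₗ e.symm.toLinearMap), fun x => ?_, fun x => ?_⟩
      · refine (tensorAlgebra_dotLift_comp _ _ x).trans ?_
        simpa using tensorAlgebra_dotLift_ι x
      · refine (tensorAlgebra_dotLift_comp _ _ x).trans ?_
        simpa using tensorAlgebra_dotLift_ι x)

/-- The concatenation product, transported to `H`. -/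
@[reducible] noncomputable def concatTwoAssoc : TwoAssocAlgebra K H where
  dot := (LinearMap.mul K (TensorAlgebra K V)).compl₁₂ (toTensorAlgebra φ).toLinearMap
    (toTensorAlgebra φ).toLinearMap |>.compr₂ (toTensorAlgebra φ).symm.toLinearMap
  dot_assoc x y z := by simp [mul_assoc]
  one_dot x := by simp [toTensorAlgebra_one]
  dot_one x := by simp [toTensorAlgebra_one]

/-- With concatenation transported as the product `·`, `H` inherits the infinitesimal relation and
the multiplicative counit from `T^c(V)`. The letters correspond to the primitive elements, and the
`·`-morphism extending the inclusion of letters is the inverse of `φ`, hence bijective. -/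
theorem exists_bialgEquiv_U2_of_coalgEquiv (φ : H ≃ₗc[K] TensorCoalgebra K V) :
    ∃ _ : BInfinityAlgebra K V, Nonempty (H ≃ₐc[K] U2 K V) := by
  let _i := concatTwoAssoc φ
  let ψ := (toTensorAlgebra φ).symm.toLinearMap
  have hψ : ∀ x y, ψ (x * y) = TwoAssocAlgebra.dot (K := K) (ψ x) (ψ y) := by
    intro x y
    change _ = (toTensorAlgebra φ).symm (toTensorAlgebra φ (ψ x) * toTensorAlgebra φ (ψ y))
    simp [ψ]
  have hlift : dotLift (ψ ∘ₗ TensorAlgebra.ι K) = ψ := by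
    refine TensorCoalgebra.linearMap_ext_aux _ _ ?_ ?_ ?_
    · rw [dotLift_one]; exact (toTensorAlgebra_symm_one φ).symm
    · exact fun v => dotLift_ι _ v
    · intro x y hx hy
      rw [dotLift_mul, hx, hy, hψ]
  refine exists_bialgEquiv_U2 (ψ ∘ₗ TensorAlgebra.ι K)
    (TensorCoalgebra.proj K V ∘ₗ (toTensorAlgebra φ).toLinearMap) ?_ ?_
    (symm_ι_mem_primitivePart φ) ?_ ?_ ?_ ?_
  · intro x y
    obtain ⟨x, rfl⟩ := (toTensorAlgebra φ).symm.surjective x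
    obtain ⟨y, rfl⟩ := (toTensorAlgebra φ).symm.surjective y
    change Coalgebra.comul (R := K) (TwoAssocAlgebra.dot (K := K) (ψ x) (ψ y)) = _
    rw [← hψ]
    refine (comul_toTensorAlgebra_symm φ _).trans ?_
    have h := TensorCoalgebra.isUnitalInfinitesimal K V x y
    refine (congrArg (TensorProduct.map ψ ψ) h).trans ?_
    rw [map_sub, map_add, map_tensorDot ψ hψ, map_tensorDot ψ hψ, comul_toTensorAlgebra_symm,
      comul_toTensorAlgebra_symm]
    simp [ψ, toTensorAlgebra_symm_one]
  · intro x y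
    rw [← counit_toTensorAlgebra φ, ← counit_toTensorAlgebra φ, ← counit_toTensorAlgebra φ]
    refine Eq.trans ?_ (TensorCoalgebra.counitAux_dot K V _ _)
    congr 1
    exact LinearEquiv.apply_symm_apply _ _
  · intro r
    rw [← counit_toTensorAlgebra φ]
    refine (congrArg _ (LinearEquiv.apply_symm_apply _ _)).trans (TensorCoalgebra.counitAux_ι K V r)
  · intro x hx
    exact (LinearEquiv.symm_apply_eq _).mpr (toTensorAlgebra_of_primitive φ x hx).symm
  · intro r
    simp [ψ, TensorCoalgebra.proj_ι]
  · rw [hlift]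
    exact (toTensorAlgebra φ).symm.bijective

end Cofree

/-! ### The two classes of bialgebras coincide -/

theorem isCofree_eq_isU2 (K : Type u) [Field K] : IsCofree.{u, v} K = IsU2.{u, v} K := by
  ext H
  constructor
  · rintro ⟨φ⟩
    obtain ⟨i, h⟩ := exists_bialgEquiv_U2_of_coalgEquiv φ
    exact ⟨_, _, _, i, h⟩
  · rintro ⟨R, _, _, _, ⟨e⟩⟩
    -- This gives `T^c(R)`, while cofreeness asks for `T^c(Prim H)`. The isomorphism itself
    -- identifies `Prim H` with `R`, and functoriality of `T^c` closes the gap.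
    let φ : H ≃ₗc[K] TensorCoalgebra K R :=
      (e : H ≃ₗc[K] U2 K R).trans (tensorCoalgebraEquivU2 K R).symm
    exact ⟨φ.trans (tensorCoalgebraCongr (primitivePartEquiv φ).symm)⟩

/-- With the properties as variables, their equality can be substituted; the identity equivalence
then commutes with the inclusions through the left unitor. -/
theorem exists_equivalence_of_eq {C : Type u} [CategoryTheory.Category.{v} C]
    {P Q : CategoryTheory.ObjectProperty C} (h : P = Q) :
    ∃ e : CategoryTheory.Equivalence P.FullSubcategory Q.FullSubcategory,
      Nonempty (CategoryTheory.Iso (CategoryTheory.Functor.comp e.functor Q.ι) P.ι) := by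
  subst h
  exact ⟨CategoryTheory.Equivalence.refl, ⟨CategoryTheory.Functor.leftUnitor _⟩⟩

end CofreeHopf

theorem mainTheorem10 (K : Type u) [Field K] :
    ∃ e : CategoryTheory.Equivalence
        (CofreeHopf.CofreeBialgebras.{u, v} K) (CofreeHopf.U2Bialgebras.{u, v} K),
      Nonempty (CategoryTheory.Iso
        (CategoryTheory.Functor.comp e.functor (CofreeHopf.IsU2.{u, v} K).ι)
        (CofreeHopf.IsCofree.{u, v} K).ι) :=
  CofreeHopf.exists_equivalence_of_eq (CofreeHopf.isCofree_eq_isU2 K)
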